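/- Let $0\le\alpha<1$ and let $\mathbb D=\{z\in\mathbb C:|z|<1\}$. Let $\mathcal S$ be the class of analytic univalent functions $f$ on $\mathbb D$ with $f(0)=0$, $f'(0)=1$, and write $g\prec h$ if $g=h\circ w$ on $\mathbb D$ for some analytic $w:\mathbb D\to\mathbb D$ with $w(0)=0$. With principal branches, and removable singularities at $0$ filled in, put $$q_\alpha(z)=\frac{(1-2\alpha)z}{(1-z)\left(1-(1-z)^{1-2\alpha}\right)},\qquad f_\alpha(z)=\frac{1-(1-z)^{2\alpha-1}}{2\alpha-1}\qquad(\alpha\ne\tfrac12),$$ $$q_{1/2}(z)=\frac{-z}{(1-z)\log(1-z)},\qquad f_{1/2}(z)=-\log(1-z),$$ and let $\mathcal S^*(q_\alpha)$ be the class of $f\in\mathcal S$ with $zf'(z)/f(z)\prec q_\alpha(z)$. Let $f\in\mathcal S^*(q_\alpha)$. Then for every $z_0$ with $|z_0|=r<1$: (i) (Growth) $-f_\alpha(-r)\le|f(z_0)|\le f_\alpha(r)$, that is, $$\frac{(1+r)^{2\alpha-1}-1}{2\alpha-1}\le|f(z_0)|\le\frac{1-(1-r)^{2\alpha-1}}{2\alpha-1}\quad(\alpha\ne\tfrac12),\qquad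 \log(1+r)\le|f(z_0)|\le-\log(1-r)\quad(\alpha=\tfrac12).$$ (ii) (Distortion) $f_\alpha'(-r)\le|f'(z_0)|\le f_\alpha'(r)$, that is, $(1+r)^{2(\alpha-1)}\le|f'(z_0)|\le(1-r)^{2(\alpha-1)}$. (iii) (Rotation) $|\arg(f(z_0)/z_0)|\le\max_{|z|=r}\arg(f_\alpha(z)/z)$, where $\arg$ is the principal argument, the quotients are given their limit value $1$ at $0$, and the maximum is attained. Moreover, for each of the five inequalities in (i), (ii), (iii), equality holds at some $z_0$ with $0<|z_0|<1$ if and only if $f$ is a rotation of $f_\alpha$, that is, $f(z)=e^{-i\theta}f_\alpha(e^{i\theta}z)$ on $\mathbb D$ for some real $\theta$. -/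

import Mathlib

/-- The class `𝒮`: functions analytic and univalent in the open unit disk, normalized by
`f 0 = 0` and `f' 0 = 1`. Only the values in the disk matter. -/
def IsNormalizedUnivalent (f : ℂ → ℂ) : Prop :=
  AnalyticOnNhd ℂ f (Metric.ball 0 1) ∧ f 0 = 0 ∧ deriv f 0 = 1 ∧
    Set.InjOn f (Metric.ball 0 1)

/-- A Schwarz function: an analytic self-map of the open unit disk that fixes `0`. -/
def IsSchwarzFunction (w : ℂ → ℂ) : Prop :=
  AnalyticOnNhd ℂ w (Metric.ball 0 1) ∧ w 0 = 0 ∧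
    Set.MapsTo w (Metric.ball 0 1) (Metric.ball 0 1)

/-- Subordination `g ≺ h` in the open unit disk. -/
def IsSubordinate (g h : ℂ → ℂ) : Prop :=
  ∃ w : ℂ → ℂ, IsSchwarzFunction w ∧ ∀ z ∈ Metric.ball (0 : ℂ) 1, g z = h (w z)

/-- The function `q_α`, with its removable singularity at `0` filled in. All powers and
logarithms are principal; `1 - z` has positive real part in the unit disk. -/
noncomputable def qAlpha (α : ℝ) (z : ℂ) : ℂ :=
  if z = 0 then 1
  else if α = 1 / 2 then -z / ((1 - z) * Complex.log (1 - z))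
  else (1 - 2 * (α : ℂ)) * z / ((1 - z) * (1 - (1 - z) ^ (1 - 2 * (α : ℂ))))

/-- The extremal function `f_α`. -/
noncomputable def fAlpha (α : ℝ) (z : ℂ) : ℂ :=
  if α = 1 / 2 then -Complex.log (1 - z)
  else (1 - (1 - z) ^ (2 * (α : ℂ) - 1)) / (2 * (α : ℂ) - 1)

/-- The function `z f'(z) / f(z)`, with its removable singularity at `0` filled in
(for `f 0 = 0`, `f' 0 = 1`). -/
noncomputable def logDerivRatio (f : ℂ → ℂ) (z : ℂ) : ℂ :=
  if z = 0 then 1 else z * deriv f z / f z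

/-- The function `f(z) / z`, with its removable singularity at `0` filled in (for `f 0 = 0`). -/
noncomputable def overId (f : ℂ → ℂ) (z : ℂ) : ℂ :=
  if z = 0 then deriv f 0 else f z / z

/-- The class `𝒮*(q_α)`. -/
def StarlikeQ (α : ℝ) : Set (ℂ → ℂ) :=
  {f | IsNormalizedUnivalent f ∧ IsSubordinate (logDerivRatio f) (qAlpha α)}

/-- In the unit disk, `f` is the rotation `z ↦ e^{-iθ} g(e^{iθ} z)` of `g` for some real `θ`. -/
def IsRotationOf (f g : ℂ → ℂ) : Prop :=
  ∃ θ : ℝ, ∀ z ∈ Metric.ball (0 : ℂ) 1,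
    f z = Complex.exp (-(θ * Complex.I)) * g (Complex.exp (θ * Complex.I) * z)

/-- The lower growth bound in explicit real form. -/
noncomputable def growthLower (α r : ℝ) : ℝ :=
  if α = 1 / 2 then Real.log (1 + r) else ((1 + r) ^ (2 * α - 1) - 1) / (2 * α - 1)

/-- The upper growth bound in explicit real form. -/
noncomputable def growthUpper (α r : ℝ) : ℝ :=
  if α = 1 / 2 then -Real.log (1 - r) else (1 - (1 - r) ^ (2 * α - 1)) / (2 * α - 1)

/-- The values of `arg (f_α(z) / z)` on the circle `|z| = r` (principal argument). -/
noncomputable def argValues (α r : ℝ) : Set ℝ :=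
  (fun z : ℂ => (overId (fAlpha α) z).arg) '' Metric.sphere 0 r

/-! Write `f(z)/z = exp (p z)` and `f_α(z)/z = exp (P z)`. Then `z P' = q_α - 1` and `z p' = q_α ∘ w
- 1` with a Schwarz function `w`, so everything reduces to the geometry of `q_α` on circles about
`0`.

The geometric input is `circleMonotone_qAlpha`: on `|z| = ρ` the real part of `q_α` decreases from
`ρ` to `-ρ` along the upper half-circle, `|q_α|` is largest at `ρ`, and `Im q_α ≥ 0` in the upper
half-disk. These properties hold for the kernels `z / (A - B z)` and survive positive combinations,
integrals and limits. Up to an elementary summand, `q_α` is such a mixture: with `x = 1 / (1 - z)`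
it involves `(x - 1) / (x ^ b - 1)`, and Cauchy's theorem on the plane slit along the negative axis
gives a positive density (`tendsto_integral_expRatioDensity`).

Growth follows by integrating `Re (q_α ∘ w - 1) / t` along a ray, using `|w(z)| ≤ |z|`
(`IsLogPrimitive.apply_le_apply`). Distortion follows from `f' = q_α(w) exp p`, since the same
points `±r` are extremal for both factors.

Rotation (`exists_mul_im_lt_logFAlpha_im`) is a maximum argument. Let `M(ρ)` be the maximum of `Im
P` on `|z| = ρ` and suppose that `± Im p(z) - M(|z|)` has a maximum over a closed disk at some `z ≠
0`. Tangential criticality gives `Re q_α = 1` at `w(z)` and at every point of the circle maximising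
`Im P`. The radial comparison gives such a point `c` with `Im q_α(c) ≤ ± Im q_α(w(z))`. If `|w(z)| <
|c|`, this contradicts the fact that on the line `Re = 1` the height `|Im q_α|` is strictly smaller
inside the circle than at `c` (`abs_qAlpha_im_lt_of_re_eq_one`).

For equality, the Schwarz lemma leaves two cases: `w` is a rotation, and then `f` is a rotation of
`f_α`, or `|w(z)| < |z|` for `z ≠ 0`, and then all five inequalities are strict. -/

open Set Filter Topology Complex
open scoped ComplexConjugate

/-! ### A closed convex cone of functions monotone along circles. -/

/-- Functions whose real part decreases along upper half-circles about `0`, and which share the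
positivity properties of the kernels `z ↦ z / (A - B z)`, `0 ≤ B ≤ A`. -/
structure CircleMonotone (g : ℂ → ℂ) : Prop where
  antitone : ∀ ρ : ℝ, 0 ≤ ρ → ρ < 1 →
    AntitoneOn (fun φ : ℝ => (g (ρ * exp (φ * I))).re) (Icc 0 Real.pi)
  norm_le : ∀ z : ℂ, ‖z‖ < 1 → ‖g z‖ ≤ (g (‖z‖ : ℂ)).re
  im_nonneg : ∀ z : ℂ, ‖z‖ < 1 → 0 ≤ z.im → 0 ≤ (g z).im
  monotone : MonotoneOn (fun t : ℝ => (g t).re) (Ioo (-1) 1)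

namespace CircleMonotone

lemma norm_polar {ρ : ℝ} (h0 : 0 ≤ ρ) (φ : ℝ) : ‖(ρ : ℂ) * exp (φ * I)‖ = ρ := by
  rw [norm_mul, norm_exp_ofReal_mul_I, mul_one, norm_real, Real.norm_of_nonneg h0]

lemma norm_norm_lt {z : ℂ} (hz : ‖z‖ < 1) : ‖((‖z‖ : ℝ) : ℂ)‖ < 1 := by simpa using hz

lemma const {c : ℝ} (hc : 0 ≤ c) : CircleMonotone (fun _ => (c : ℂ)) where
  antitone _ _ _ _ _ _ _ _ := le_rfl
  norm_le _ _ := by simp [abs_of_nonneg hc]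
  im_nonneg _ _ _ := by simp
  monotone _ _ _ _ _ := le_rfl

lemma add {g h : ℂ → ℂ} (hg : CircleMonotone g) (hh : CircleMonotone h) :
    CircleMonotone (fun z => g z + h z) where
  antitone ρ h0 h1 a ha b hb hab := by
    have := hg.antitone ρ h0 h1 ha hb hab
    have := hh.antitone ρ h0 h1 ha hb hab
    simp only [add_re] at *
    linarith
  norm_le z hz := by
    have := hg.norm_le z hz
    have := hh.norm_le z hz
    have := norm_add_le (g z) (h z)
    simp only [add_re] at *
    linarith
  im_nonneg z hz hi := by
    have := hg.im_nonneg z hz hi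
    have := hh.im_nonneg z hz hi
    simp only [add_im]
    linarith
  monotone a ha b hb hab := by
    have := hg.monotone ha hb hab
    have := hh.monotone ha hb hab
    simp only [add_re] at *
    linarith

lemma const_mul {g : ℂ → ℂ} (hg : CircleMonotone g) {c : ℝ} (hc : 0 ≤ c) :
    CircleMonotone (fun z => (c : ℂ) * g z) where
  antitone ρ h0 h1 a ha b hb hab := by
    have := hg.antitone ρ h0 h1 ha hb hab
    simp only [re_ofReal_mul] at *
    exact mul_le_mul_of_nonneg_left this hc
  norm_le z hz := by
    have := hg.norm_le z hz
    simp only [re_ofReal_mul, norm_mul, norm_real, Real.norm_of_nonneg hc]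
    exact mul_le_mul_of_nonneg_left this hc
  im_nonneg z hz hi := by
    have := hg.im_nonneg z hz hi
    simp only [im_ofReal_mul]
    positivity
  monotone a ha b hb hab := by
    have := hg.monotone ha hb hab
    simp only [re_ofReal_mul] at *
    exact mul_le_mul_of_nonneg_left this hc

lemma congr {g h : ℂ → ℂ} (hg : CircleMonotone g) (e : ∀ z, ‖z‖ < 1 → g z = h z) :
    CircleMonotone h where
  antitone ρ h0 h1 a ha b hb hab := by
    have := hg.antitone ρ h0 h1 ha hb hab
    simp only at this
    rwa [e _ (by rwa [norm_polar h0]), e _ (by rwa [norm_polar h0])] at this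
  norm_le z hz := by
    have := hg.norm_le z hz
    rwa [e _ hz, e _ (norm_norm_lt hz)] at this
  im_nonneg z hz hi := by
    have := hg.im_nonneg z hz hi
    rwa [e _ hz] at this
  monotone a ha b hb hab := by
    have := hg.monotone ha hb hab
    simp only at this
    rwa [e _ (by simpa [abs_lt] using ha), e _ (by simpa [abs_lt] using hb)] at this

/-- All four conditions are non-strict inequalities between finitely many values, so pointwise
limits keep them; strictness has to be recovered later by analyticity. -/
lemma of_tendsto {ι : Type*} {l : Filter ι} [l.NeBot] {G : ι → ℂ → ℂ} {g : ℂ → ℂ}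
    (hG : ∀ᶠ i in l, CircleMonotone (G i))
    (h : ∀ z, ‖z‖ < 1 → Tendsto (fun i => G i z) l (𝓝 (g z))) : CircleMonotone g where
  antitone ρ h0 h1 a ha b hb hab := by
    have hn : ∀ φ : ℝ, Tendsto (fun i => (G i (ρ * exp (φ * I))).re) l
        (𝓝 (g (ρ * exp (φ * I))).re) := fun φ =>
      (continuous_re.tendsto _).comp (h _ (by rwa [norm_polar h0]))
    exact le_of_tendsto_of_tendsto (hn b) (hn a)
      (hG.mono fun i hi => hi.antitone ρ h0 h1 ha hb hab)
  norm_le z hz :=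
    le_of_tendsto_of_tendsto (h z hz).norm
      ((continuous_re.tendsto _).comp (h _ (norm_norm_lt hz))) (hG.mono fun i hi => hi.norm_le z hz)
  im_nonneg z hz hi :=
    ge_of_tendsto ((continuous_im.tendsto _).comp (h z hz))
      (hG.mono fun i h => h.im_nonneg z hz hi)
  monotone a ha b hb hab :=
    le_of_tendsto_of_tendsto
      ((continuous_re.tendsto _).comp (h a (by simpa [abs_lt] using ha)))
      ((continuous_re.tendsto _).comp (h b (by simpa [abs_lt] using hb)))
      (hG.mono fun i hi => hi.monotone ha hb hab)

lemma intervalIntegral {G : ℝ → ℂ → ℂ} {a b : ℝ} (hab : a ≤ b)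
    (hG : ∀ s, CircleMonotone (G s)) (hc : ∀ z, ‖z‖ < 1 → Continuous fun s => G s z) :
    CircleMonotone (fun z => ∫ s in a..b, G s z) := by
  have hre : ∀ z, ‖z‖ < 1 → (∫ s in a..b, G s z).re = ∫ s in a..b, (G s z).re := fun z hz =>
    (reCLM.intervalIntegral_comp_comm ((hc z hz).intervalIntegrable a b)).symm
  have him : ∀ z, ‖z‖ < 1 → (∫ s in a..b, G s z).im = ∫ s in a..b, (G s z).im := fun z hz =>
    (imCLM.intervalIntegral_comp_comm ((hc z hz).intervalIntegrable a b)).symm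
  have hi : ∀ z, ‖z‖ < 1 → IntervalIntegrable (fun s => (G s z).re) MeasureTheory.volume a b :=
    fun z hz => (continuous_re.comp (hc z hz)).intervalIntegrable a b
  refine ⟨fun ρ h0 h1 s hs t ht hst => ?_, fun z hz => ?_, fun z hz h => ?_,
    fun s hs t ht hst => ?_⟩
  · have hn : ∀ φ : ℝ, ‖(ρ : ℂ) * exp (φ * I)‖ < 1 := fun φ => by rwa [norm_polar h0]
    simp only [hre _ (hn _)]
    exact intervalIntegral.integral_mono hab (hi _ (hn t)) (hi _ (hn s))
      fun r => (hG r).antitone ρ h0 h1 hs ht hst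
  · rw [hre _ (norm_norm_lt hz)]
    refine (intervalIntegral.norm_integral_le_integral_norm hab).trans ?_
    exact intervalIntegral.integral_mono hab ((hc z hz).norm.intervalIntegrable a b)
      (hi _ (norm_norm_lt hz)) fun r => (hG r).norm_le z hz
  · rw [him z hz]
    exact intervalIntegral.integral_nonneg hab fun r _ => (hG r).im_nonneg z hz h
  · have hs' : ‖(s : ℂ)‖ < 1 := by simpa [abs_lt] using hs
    have ht' : ‖(t : ℂ)‖ < 1 := by simpa [abs_lt] using ht
    simp only [hre _ hs', hre _ ht']
    exact intervalIntegral.integral_mono hab (hi _ hs') (hi _ ht')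
      fun r => (hG r).monotone hs ht hst

lemma kernel_denominator_pos {A B : ℝ} (hB : 0 ≤ B) (hBA : B ≤ A) (hA : 0 < A) {z : ℂ}
    (hz : ‖z‖ < 1) : 0 < A - B * ‖z‖ := by
  rcases hB.eq_or_lt with rfl | hB
  · simpa using hA
  · nlinarith

lemma kernel_denominator_ne_zero {A B : ℝ} (hB : 0 ≤ B) (hBA : B ≤ A) (hA : 0 < A) {z : ℂ}
    (hz : ‖z‖ < 1) : (A : ℂ) - B * z ≠ 0 := by
  intro h
  have h1 := kernel_denominator_pos hB hBA hA hz
  have h2 : ‖(A : ℂ)‖ = ‖(B : ℂ) * z‖ := by rw [sub_eq_zero.1 h]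
  rw [norm_mul, norm_real, norm_real, Real.norm_of_nonneg hB, Real.norm_of_nonneg hA.le] at h2
  linarith

/-- On a fixed circle `|A - B z|²` is affine in `Re z`, so the real part is a Möbius function of `Re
z`, and only the sign of its determinant matters. -/
lemma kernel {A B : ℝ} (hB : 0 ≤ B) (hBA : B ≤ A) (hA : 0 < A) :
    CircleMonotone (fun z => z / (A - B * z)) := by
  have key : ∀ z : ℂ, ‖z‖ < 1 →
      0 < A ^ 2 - 2 * A * B * z.re + B ^ 2 * ‖z‖ ^ 2 ∧
      (z / (A - B * z)).re =
        (A * z.re - B * ‖z‖ ^ 2) / (A ^ 2 - 2 * A * B * z.re + B ^ 2 * ‖z‖ ^ 2) ∧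
      (z / (A - B * z)).im = A * z.im / (A ^ 2 - 2 * A * B * z.re + B ^ 2 * ‖z‖ ^ 2) := by
    intro z hz
    have hD : normSq ((A : ℂ) - B * z) = A ^ 2 - 2 * A * B * z.re + B ^ 2 * ‖z‖ ^ 2 := by
      rw [Complex.sq_norm, normSq_apply, normSq_apply]
      simp
      ring
    have hp : 0 < normSq ((A : ℂ) - B * z) :=
      normSq_pos.2 (kernel_denominator_ne_zero hB hBA hA hz)
    refine ⟨hD ▸ hp, ?_, ?_⟩
    · rw [div_re, hD, Complex.sq_norm, normSq_apply, ← add_div]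
      congr 1
      simp
      ring
    · rw [div_im, hD, ← sub_div]
      congr 1
      simp
      ring
  refine ⟨fun ρ h0 h1 s hs t ht hst => ?_, fun z hz => ?_, fun z hz h => ?_,
    fun s hs t ht hst => ?_⟩
  · have hn : ∀ φ : ℝ, ‖(ρ : ℂ) * exp (φ * I)‖ < 1 := fun φ => by rwa [norm_polar h0]
    obtain ⟨p1, e1, -⟩ := key _ (hn s)
    obtain ⟨p2, e2, -⟩ := key _ (hn t)
    simp only [e1, e2, norm_polar h0] at p1 p2 ⊢
    have hcos : ((ρ : ℂ) * exp (t * I)).re ≤ ((ρ : ℂ) * exp (s * I)).re := by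
      simp only [re_ofReal_mul, exp_ofReal_mul_I_re]
      exact mul_le_mul_of_nonneg_left
        (Real.cos_le_cos_of_nonneg_of_le_pi hs.1 ht.2 hst) h0
    rw [div_le_div_iff₀ p2 p1]
    generalize ((ρ : ℂ) * exp (t * I)).re = a at *
    generalize ((ρ : ℂ) * exp (s * I)).re = c at *
    have hBρ : B * ρ ≤ A := by nlinarith
    -- This product is exactly the difference of the two sides after cross-multiplication.
    have : 0 ≤ A * (A - B * ρ) * (A + B * ρ) * (c - a) := by
      have := mul_nonneg hB h0
      have : 0 ≤ c - a := by linarith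
      have : 0 ≤ A - B * ρ := by linarith
      positivity
    nlinarith
  · have hp := kernel_denominator_pos hB hBA hA hz
    have e : (((‖z‖ : ℝ) : ℂ) / (A - B * ((‖z‖ : ℝ) : ℂ))) =
        ((‖z‖ / (A - B * ‖z‖) : ℝ) : ℂ) := by push_cast; ring
    rw [e, ofReal_re, norm_div]
    refine div_le_div_of_nonneg_left (norm_nonneg z) hp ?_
    have := norm_sub_norm_le (A : ℂ) (B * z)
    rwa [norm_mul, norm_real, norm_real, Real.norm_of_nonneg hB,
      Real.norm_of_nonneg hA.le] at this
  · obtain ⟨p1, -, e1⟩ := key _ hz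
    rw [e1]
    positivity
  · have hs' : ‖(s : ℂ)‖ < 1 := by simpa [abs_lt] using hs
    have ht' : ‖(t : ℂ)‖ < 1 := by simpa [abs_lt] using ht
    have e : ∀ t : ℝ, ((t : ℂ) / (A - B * t)) = ((t / (A - B * t) : ℝ) : ℂ) := by
      intro t; push_cast; ring
    have hp : ∀ t : ℝ, ‖(t : ℂ)‖ < 1 → 0 < A - B * t := fun t h => by
      have := kernel_denominator_pos hB hBA hA h
      rw [norm_real] at this
      nlinarith [mul_le_mul_of_nonneg_left (le_abs_self t) hB, Real.norm_eq_abs t]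
    simp only [e, ofReal_re]
    rw [div_le_div_iff₀ (hp s hs') (hp t ht')]
    nlinarith

end CircleMonotone

/-! ### Integral representation of `(x - 1) / (x ^ b - 1)`, in the variable `τ = log x`. -/

lemma exp_ne_exp_of_abs_im_sub_lt {s t : ℂ} (hst : s ≠ t) (h : |s.im - t.im| < 2 * Real.pi) :
    exp s ≠ exp t := by
  intro e
  obtain ⟨n, hn⟩ := exp_eq_exp_iff_exists_int.1 e
  have him : s.im - t.im = n * (2 * Real.pi) := by
    rw [hn]; simp
  have hpi := Real.pi_pos
  rw [him, abs_mul, abs_of_pos (by positivity : (0 : ℝ) < 2 * Real.pi)] at h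
  have h1 : |(n : ℝ)| < 1 := by nlinarith
  have h2 : n = 0 := Int.abs_lt_one_iff.1 (by exact_mod_cast h1)
  apply hst
  rw [hn, h2]; simp

lemma dslope_exp_ne_zero {s t : ℂ} (h : |s.im - t.im| < 2 * Real.pi) : dslope exp t s ≠ 0 := by
  rcases eq_or_ne s t with rfl | hst
  · simp [dslope_same, exp_ne_zero]
  · rw [dslope_of_ne _ hst, slope_def_field]
    exact div_ne_zero (sub_ne_zero.2 (exp_ne_exp_of_abs_im_sub_lt hst h)) (sub_ne_zero.2 hst)

/-- The function `(e^τ - 1) / (e^{bτ} - 1)`, with its removable singularity at `0` filled in. -/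
noncomputable def expRatio (b : ℝ) (τ : ℂ) : ℂ := dslope exp 0 τ / (b * dslope exp 0 (b * τ))

lemma expRatio_zero (b : ℝ) : expRatio b 0 = 1 / b := by
  simp [expRatio, dslope_same]

lemma expRatio_of_ne {b : ℝ} (hb : b ≠ 0) {τ : ℂ} (hτ : τ ≠ 0) :
    expRatio b τ = (exp τ - 1) / (exp (b * τ) - 1) := by
  have hb' : (b : ℂ) ≠ 0 := by exact_mod_cast hb
  rw [expRatio, dslope_of_ne _ hτ, dslope_of_ne _ (mul_ne_zero hb' hτ), slope_def_field,
    slope_def_field, exp_zero, sub_zero, sub_zero]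
  by_cases h : exp (b * τ) - 1 = 0
  · simp [h]
  · field_simp

lemma isOpen_strip : IsOpen {τ : ℂ | |τ.im| < 2 * Real.pi} :=
  isOpen_lt (continuous_abs.comp continuous_im) continuous_const

lemma differentiable_dslope_exp (c : ℂ) : Differentiable ℂ (dslope exp c) :=
  differentiableOn_univ.1 ((differentiableOn_dslope univ_mem).2 differentiable_exp.differentiableOn)

/-- Apart from `0`, the zeros of `exp (b τ) - 1` on the imaginary axis start at height `2π / b >
2π`. -/
lemma differentiableOn_expRatio {b : ℝ} (hb0 : 0 < b) (hb1 : b < 1) :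
    DifferentiableOn ℂ (expRatio b) {τ : ℂ | |τ.im| < 2 * Real.pi} := by
  have h := differentiable_dslope_exp 0
  refine h.differentiableOn.div ?_ fun τ hτ => ?_
  · exact (((differentiable_const _).mul (h.comp ((differentiable_const _).mul
      differentiable_id)))).differentiableOn
  · refine mul_ne_zero (by exact_mod_cast hb0.ne') (dslope_exp_ne_zero ?_)
    simp only [mem_ofPred_eq] at hτ
    simp only [im_ofReal_mul, zero_im, sub_zero, abs_mul, abs_of_pos hb0]
    nlinarith [abs_nonneg τ.im]

/-- The Cauchy integrand whose contour integral represents `expRatio b τ₀ - expRatio b 0`. -/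
noncomputable def expRatioIntegrand (b : ℝ) (τ₀ τ : ℂ) : ℂ :=
  dslope (expRatio b) τ₀ τ * (exp τ / dslope exp τ₀ τ) -
    dslope (expRatio b) 0 τ * (exp τ / dslope exp 0 τ)

/-- In `ξ = exp τ` this is the Cauchy kernel at `x = exp τ₀` minus the one at `1`. The difference
cancels the factor `ξ - 1` in the numerator of `expRatio`, which produces the decay at the right end
of the strip. -/
lemma expRatioIntegrand_eq {b : ℝ} (hb : b ≠ 0) {τ₀ τ : ℂ} (h0 : exp τ ≠ exp τ₀)
    (h1 : exp τ ≠ 1) (h2 : exp (b * τ) ≠ 1) :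
    expRatioIntegrand b τ₀ τ =
      exp τ * (exp τ₀ - 1) / ((exp (b * τ) - 1) * (exp τ - exp τ₀)) -
        expRatio b τ₀ * exp τ / (exp τ - exp τ₀) + expRatio b 0 * exp τ / (exp τ - 1) := by
  have n0 : τ ≠ τ₀ := by rintro rfl; exact h0 rfl
  have n1 : τ ≠ 0 := by rintro rfl; exact h1 exp_zero
  have key : ∀ c, τ ≠ c → exp τ ≠ exp c → dslope (expRatio b) c τ * (exp τ / dslope exp c τ) =
      (expRatio b τ - expRatio b c) * exp τ / (exp τ - exp c) := by
    intro c hc he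
    have := sub_ne_zero.2 hc
    have := sub_ne_zero.2 he
    rw [dslope_of_ne _ hc, dslope_of_ne _ hc, slope_def_field, slope_def_field]
    field_simp
  rw [expRatioIntegrand, key _ n0 h0, key _ n1 (by rwa [exp_zero]), expRatio_of_ne hb n1, exp_zero]
  have := sub_ne_zero.2 h0
  have := sub_ne_zero.2 h1
  have := sub_ne_zero.2 h2
  field_simp
  ring

/-- The divided differences remove the poles at `τ₀` and `0`; `exp` takes these two values nowhere
else in the closed strip, so no residues arise. -/
lemma differentiableOn_expRatioIntegrand {b : ℝ} (hb0 : 0 < b) (hb1 : b < 1) {τ₀ : ℂ}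
    (hτ₀ : |τ₀.im| < Real.pi) :
    DifferentiableOn ℂ (expRatioIntegrand b τ₀) {τ : ℂ | |τ.im| ≤ Real.pi} := by
  have hpi := Real.pi_pos
  have hsub : {τ : ℂ | |τ.im| ≤ Real.pi} ⊆ {τ : ℂ | |τ.im| < 2 * Real.pi} := fun τ hτ => by
    simp only [mem_ofPred_eq] at *; linarith
  have key : ∀ c : ℂ, |c.im| < Real.pi → DifferentiableOn ℂ
      (fun τ => dslope (expRatio b) c τ * (exp τ / dslope exp c τ)) {τ : ℂ | |τ.im| ≤ Real.pi} := by
    intro c hc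
    refine DifferentiableOn.mul ?_ (differentiable_exp.differentiableOn.div
      (differentiable_dslope_exp c).differentiableOn fun τ hτ => dslope_exp_ne_zero ?_)
    · refine ((differentiableOn_dslope (isOpen_strip.mem_nhds ?_)).2
        (differentiableOn_expRatio hb0 hb1)).mono hsub
      simp only [mem_ofPred_eq]; linarith
    · simp only [mem_ofPred_eq] at hτ
      have := abs_sub τ.im c.im
      linarith
  exact (key τ₀ hτ₀).sub (key 0 (by simpa using hpi))

/-- The density in the integral representation of `expRatio`. -/
noncomputable def expRatioDensity (b s : ℝ) : ℝ :=
  Real.sin (b * Real.pi) / Real.pi * (Real.exp s * Real.exp (b * s)) /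
    (Real.exp (b * s) ^ 2 - 2 * Real.exp (b * s) * Real.cos (b * Real.pi) + 1)

lemma sin_mul_pi_pos {b : ℝ} (hb0 : 0 < b) (hb1 : b < 1) : 0 < Real.sin (b * Real.pi) :=
  Real.sin_pos_of_pos_of_lt_pi (by positivity) (by nlinarith [Real.pi_pos])

lemma expRatioDensity_denominator_pos {b : ℝ} (hb0 : 0 < b) (hb1 : b < 1) (s : ℝ) :
    0 < Real.exp (b * s) ^ 2 - 2 * Real.exp (b * s) * Real.cos (b * Real.pi) + 1 := by
  have h1 := sin_mul_pi_pos hb0 hb1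
  have h2 := Real.sin_sq_add_cos_sq (b * Real.pi)
  nlinarith [sq_nonneg (Real.exp (b * s) - Real.cos (b * Real.pi))]

lemma expRatioDensity_nonneg {b : ℝ} (hb0 : 0 < b) (hb1 : b < 1) (s : ℝ) :
    0 ≤ expRatioDensity b s := by
  have h1 := sin_mul_pi_pos hb0 hb1
  have h2 := expRatioDensity_denominator_pos hb0 hb1 s
  have := Real.pi_pos
  unfold expRatioDensity
  positivity

lemma continuous_expRatioDensity {b : ℝ} (hb0 : 0 < b) (hb1 : b < 1) :
    Continuous (expRatioDensity b) := by
  unfold expRatioDensity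
  exact Continuous.div (by fun_prop) (by fun_prop)
    fun s => (expRatioDensity_denominator_pos hb0 hb1 s).ne'

lemma exp_ne_neg_exp {τ₀ : ℂ} (hτ₀ : |τ₀.im| < Real.pi) (s : ℝ) : exp τ₀ ≠ -exp s := by
  have hpi := Real.pi_pos
  have h : exp τ₀ ≠ exp (s + Real.pi * I) := by
    apply exp_ne_exp_of_abs_im_sub_lt
    · rintro rfl
      simp [abs_of_pos hpi] at hτ₀
    · simp only [add_im, ofReal_im, mul_im, ofReal_re, I_re, I_im]
      have := abs_lt.1 hτ₀
      rw [abs_lt]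
      constructor <;> linarith [this.1, this.2]
  rwa [exp_add, exp_pi_mul_I, mul_neg_one] at h

/-- The edges `Im τ = ±π` are the two sides of the slit at `ξ = -exp s`. Only `exp (b τ)` differs
between them; the terms with the constants `expRatio b τ₀` and `expRatio b 0` cancel. -/
lemma expRatioIntegrand_jump {b : ℝ} (hb0 : 0 < b) (hb1 : b < 1) {τ₀ : ℂ}
    (hτ₀ : |τ₀.im| < Real.pi) (s : ℝ) :
    expRatioIntegrand b τ₀ (s + (-Real.pi : ℝ) * I) - expRatioIntegrand b τ₀ (s + Real.pi * I) =
      2 * Real.pi * I * (expRatioDensity b s * ((exp τ₀ - 1) / (exp τ₀ + exp s))) := by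
  have hs := sin_mul_pi_pos hb0 hb1
  have hN := expRatioDensity_denominator_pos hb0 hb1 s
  have hpi : (Real.pi : ℂ) ≠ 0 := by exact_mod_cast Real.pi_ne_zero
  have e1 : exp ((s : ℂ) + (-Real.pi : ℝ) * I) = -exp s := by
    rw [exp_add, ofReal_neg, neg_mul, exp_neg_pi_mul_I, mul_neg_one]
  have e2 : exp ((s : ℂ) + Real.pi * I) = -exp s := by
    rw [exp_add, exp_pi_mul_I, mul_neg_one]
  have f2 : exp ((b : ℂ) * (s + Real.pi * I)) =
      (Real.exp (b * s) : ℂ) * (Real.cos (b * Real.pi) + Real.sin (b * Real.pi) * I) := by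
    rw [mul_add, exp_add, ← mul_assoc, exp_mul_I]; push_cast; ring
  have f1 : exp ((b : ℂ) * (s + (-Real.pi : ℝ) * I)) =
      (Real.exp (b * s) : ℂ) * (Real.cos (b * Real.pi) - Real.sin (b * Real.pi) * I) := by
    rw [mul_add, exp_add, ← mul_assoc, exp_mul_I]; push_cast
    rw [mul_neg, Complex.cos_neg, Complex.sin_neg]; ring
  have hE := Real.exp_pos (b * s)
  have es : exp (s : ℂ) = (Real.exp s : ℂ) := by push_cast; rfl
  have hne : ∀ ε : ℝ, ε ^ 2 = 1 → (Real.exp (b * s) : ℂ) *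
      (Real.cos (b * Real.pi) + ε * Real.sin (b * Real.pi) * I) - 1 ≠ 0 := by
    intro ε hε h
    have := congrArg im h
    simp [-ofReal_exp, -ofReal_cos, -ofReal_sin] at this
    rcases this with h | h
    · simp [h] at hε
    · exact hs.ne' h
  have g1 := hne (-1) (by norm_num)
  have g2 := hne 1 (by norm_num)
  have hxs : exp τ₀ + exp s ≠ 0 := fun h => exp_ne_neg_exp hτ₀ s (eq_neg_of_add_eq_zero_left h)
  have h1s : (-exp (s : ℂ)) ≠ 1 := by
    rw [es]
    intro h
    have := congrArg re h
    simp [-ofReal_exp] at this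
    linarith [Real.exp_pos s]
  have hD : (Real.exp (b * s) : ℂ) ^ 2 - 2 * Real.exp (b * s) * Real.cos (b * Real.pi) + 1 ≠ 0 := by
    exact_mod_cast hN.ne'
  have hcs : (Real.sin (b * Real.pi) : ℂ) ^ 2 + (Real.cos (b * Real.pi) : ℂ) ^ 2 = 1 := by
    exact_mod_cast Real.sin_sq_add_cos_sq (b * Real.pi)
  rw [expRatioIntegrand_eq hb0.ne' (by rw [e1]; exact (exp_ne_neg_exp hτ₀ s).symm)
      (by rw [e1]; exact h1s) (by rw [f1]; exact sub_ne_zero.1 (by convert g1 using 2; push_cast; ring)),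
    expRatioIntegrand_eq hb0.ne' (by rw [e2]; exact (exp_ne_neg_exp hτ₀ s).symm)
      (by rw [e2]; exact h1s) (by rw [f2]; exact sub_ne_zero.1 (by convert g2 using 2; push_cast; ring)),
    e1, e2, f1, f2, expRatioDensity, es]
  push_cast [-ofReal_exp, -ofReal_cos, -ofReal_sin] at g1 g2 ⊢
  rw [es] at hxs
  generalize (Real.exp (b * s) : ℂ) = E at *
  generalize (Real.cos (b * Real.pi) : ℂ) = c at *
  generalize (Real.sin (b * Real.pi) : ℂ) = d at *
  generalize (Real.exp s : ℂ) = e at *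
  generalize exp τ₀ = x at *
  have g1' : E * (c - d * I) - 1 ≠ 0 := by convert g1 using 2; ring
  have g2' : E * (c + d * I) - 1 ≠ 0 := by convert g2 using 2; ring
  -- The factors are conjugate, and their product is the denominator of the density.
  have hprod : (E * (c - d * I) - 1) * (E * (c + d * I) - 1) = E ^ 2 - 2 * E * c + 1 := by
    linear_combination E ^ 2 * hcs - E ^ 2 * d ^ 2 * I_sq
  have hxs' : -e - x ≠ 0 := by
    intro h; apply hxs; linear_combination -h
  rw [← hprod]
  field_simp
  ring

/-- The side has fixed length `2π`, so a bound uniform in `y` is enough. -/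
lemma tendsto_integral_vertical {F : ℂ → ℂ} {c : ℂ} {ε X : ℝ → ℝ} {l : Filter ℝ}
    (hε : Tendsto ε l (𝓝 0)) (h : ∀ᶠ R in l, ∀ y : ℝ, ‖F (X R + y * I) - c‖ ≤ ε R)
    (hi : ∀ R, IntervalIntegrable (fun y : ℝ => F (X R + y * I)) MeasureTheory.volume
      (-Real.pi) Real.pi) :
    Tendsto (fun R => ∫ y in (-Real.pi)..Real.pi, F (X R + y * I)) l (𝓝 (2 * Real.pi * c)) := by
  rw [tendsto_iff_norm_sub_tendsto_zero]
  have h2 : Tendsto (fun R => ε R * (2 * Real.pi)) l (𝓝 0) := by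
    simpa using hε.mul_const (2 * Real.pi)
  refine squeeze_zero' (Eventually.of_forall fun _ => norm_nonneg _) ?_ h2
  filter_upwards [h] with R hR
  have e : (∫ y in (-Real.pi)..Real.pi, F (X R + y * I)) - 2 * Real.pi * c =
      ∫ y in (-Real.pi)..Real.pi, (F (X R + y * I) - c) := by
    rw [intervalIntegral.integral_sub (hi R) intervalIntegrable_const,
      intervalIntegral.integral_const]
    rw [sub_neg_eq_add, ← two_mul, real_smul]
    push_cast; rfl
  rw [e]
  refine (intervalIntegral.norm_integral_le_of_norm_le_const fun y _ => hR y).trans_eq ?_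
  rw [sub_neg_eq_add, ← two_mul, abs_of_pos (by positivity)]

lemma norm_exp_add_mul_I (x y : ℝ) : ‖exp ((x : ℂ) + y * I)‖ = Real.exp x := by
  rw [norm_exp]; simp

lemma norm_exp_mul_add_mul_I (b x y : ℝ) :
    ‖exp ((b : ℂ) * ((x : ℂ) + y * I))‖ = Real.exp (b * x) := by
  rw [norm_exp]; simp

lemma intervalIntegrable_vertical {b : ℝ} (hb0 : 0 < b) (hb1 : b < 1) {τ₀ : ℂ}
    (hτ₀ : |τ₀.im| < Real.pi) (X : ℝ) :
    IntervalIntegrable (fun y : ℝ => expRatioIntegrand b τ₀ (X + y * I)) MeasureTheory.volume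
      (-Real.pi) Real.pi := by
  have hpi := Real.pi_pos
  apply ContinuousOn.intervalIntegrable
  refine (differentiableOn_expRatioIntegrand hb0 hb1 hτ₀).continuousOn.comp (by fun_prop) ?_
  intro y hy
  rw [uIcc_of_le (by linarith)] at hy
  simpa [abs_le] using hy

lemma intervalIntegrable_horizontal {b : ℝ} (hb0 : 0 < b) (hb1 : b < 1) {τ₀ : ℂ}
    (hτ₀ : |τ₀.im| < Real.pi) {y : ℝ} (hy : |y| ≤ Real.pi) (c d : ℝ) :
    IntervalIntegrable (fun x : ℝ => expRatioIntegrand b τ₀ (x + y * I)) MeasureTheory.volume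
      c d := by
  apply Continuous.intervalIntegrable
  refine (differentiableOn_expRatioIntegrand hb0 hb1 hτ₀).continuousOn.comp_continuous
    (by fun_prop) ?_
  intro x
  simpa using hy

lemma tendsto_exp_neg_mul {b : ℝ} (hb0 : 0 < b) :
    Tendsto (fun R : ℝ => Real.exp (-(b * R))) atTop (𝓝 0) :=
  Real.tendsto_exp_neg_atTop_nhds_zero.comp (tendsto_id.const_mul_atTop hb0)

/-- As `Re τ → ∞` the term with `exp (b τ) - 1` in its denominator dies and both constant terms
survive. -/
lemma tendsto_right_side {b : ℝ} (hb0 : 0 < b) (hb1 : b < 1) {τ₀ : ℂ}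
    (hτ₀ : |τ₀.im| < Real.pi) :
    Tendsto (fun R : ℝ => ∫ y in (-Real.pi)..Real.pi, expRatioIntegrand b τ₀ ((R : ℝ) + y * I))
      atTop (𝓝 (2 * Real.pi * (expRatio b 0 - expRatio b τ₀))) := by
  set x := exp τ₀ with hx
  set A := ‖expRatio b τ₀‖
  set B := ‖expRatio b 0‖
  have hδ : Tendsto (fun R : ℝ => Real.exp (-R)) atTop (𝓝 0) :=
    Real.tendsto_exp_neg_atTop_nhds_zero
  have hη := tendsto_exp_neg_mul hb0
  -- The error bound written in `exp (-R)` and `exp (-(b * R))`: a rational function continuous at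
  -- the origin and zero there.
  set Ψ : ℝ × ℝ → ℝ := fun p => p.2 / (1 - p.2) * (‖x - 1‖ / (1 - ‖x‖ * p.1)) +
    A * (‖x‖ * p.1 / (1 - ‖x‖ * p.1)) + B * (p.1 / (1 - p.1)) with hΨ
  have hc : Tendsto Ψ (𝓝 (0, 0)) (𝓝 0) := by
    have : ContinuousAt Ψ (0, 0) := by
      simp only [hΨ]
      refine ((ContinuousAt.mul (.div ?_ ?_ (by simp)) (.div ?_ ?_ (by simp))).add
        (.mul ?_ (.div ?_ ?_ (by simp)))).add (.mul ?_ (.div ?_ ?_ (by simp))) <;> fun_prop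
    have h2 := this.tendsto
    simpa [hΨ] using h2
  have hδη : Tendsto (fun R : ℝ => (Real.exp (-R), Real.exp (-(b * R)))) atTop (𝓝 (0, 0)) :=
    hδ.prodMk_nhds hη
  refine tendsto_integral_vertical (hc.comp hδη) ?_
    (fun R => intervalIntegrable_vertical hb0 hb1 hτ₀ R)
  have e1 : ∀ᶠ R : ℝ in atTop, Real.exp (-R) * ‖x‖ < 1 := by
    have : Tendsto (fun R : ℝ => Real.exp (-R) * ‖x‖) atTop (𝓝 0) := by
      simpa using hδ.mul_const ‖x‖
    exact this.eventually_lt_const one_pos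
  have e2 := hδ.eventually_lt_const one_pos
  have e3 := hη.eventually_lt_const one_pos
  filter_upwards [e1, e2, e3] with R h1 h2 h3 y
  have hX := norm_exp_add_mul_I R y
  have hY := norm_exp_mul_add_mul_I b R y
  have hd : 0 < Real.exp R := Real.exp_pos R
  have hd' : 0 < Real.exp (b * R) := Real.exp_pos _
  rw [Real.exp_neg] at h1 h2 h3
  have k1 : ‖x‖ < Real.exp R := by
    rwa [inv_mul_lt_iff₀ hd, mul_one] at h1
  have k2 : 1 < Real.exp R := (inv_lt_one₀ hd).1 h2
  have k3 : 1 < Real.exp (b * R) := (inv_lt_one₀ hd').1 h3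
  set τ : ℂ := (R : ℂ) + y * I
  have n1 : Real.exp R - ‖x‖ ≤ ‖exp τ - x‖ := hX ▸ norm_sub_norm_le _ _
  have n2 : Real.exp R - 1 ≤ ‖exp τ - 1‖ := by
    have := norm_sub_norm_le (exp τ) 1
    rwa [hX, norm_one] at this
  have n3 : Real.exp (b * R) - 1 ≤ ‖exp (b * τ) - 1‖ := by
    have := norm_sub_norm_le (exp (b * τ)) 1
    rwa [hY, norm_one] at this
  have z1 : exp τ - x ≠ 0 := norm_pos_iff.1 (by linarith)
  have z2 : exp τ - 1 ≠ 0 := norm_pos_iff.1 (by linarith)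
  have z3 : exp (b * τ) - 1 ≠ 0 := norm_pos_iff.1 (by linarith)
  rw [expRatioIntegrand_eq hb0.ne' (sub_ne_zero.1 z1) (sub_ne_zero.1 z2) (sub_ne_zero.1 z3)]
  have e : exp τ * (exp τ₀ - 1) / ((exp (b * τ) - 1) * (exp τ - exp τ₀)) -
        expRatio b τ₀ * exp τ / (exp τ - exp τ₀) + expRatio b 0 * exp τ / (exp τ - 1) -
        (expRatio b 0 - expRatio b τ₀) =
      exp τ * (x - 1) / ((exp (b * τ) - 1) * (exp τ - x)) +
        (-(expRatio b τ₀ * (x / (exp τ - x))) + expRatio b 0 * (1 / (exp τ - 1))) := by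
    rw [← hx]
    field_simp
    ring
  rw [e]
  have hΨ' : (Ψ ∘ fun R : ℝ => (Real.exp (-R), Real.exp (-(b * R)))) R =
      Real.exp R * ‖x - 1‖ / ((Real.exp (b * R) - 1) * (Real.exp R - ‖x‖)) +
        (A * (‖x‖ / (Real.exp R - ‖x‖)) + B * (1 / (Real.exp R - 1))) := by
    simp only [Function.comp, hΨ, Real.exp_neg]
    have : Real.exp R - ‖x‖ ≠ 0 := by linarith
    have : Real.exp R - 1 ≠ 0 := by linarith
    have : Real.exp (b * R) - 1 ≠ 0 := by linarith
    have : 1 - ‖x‖ * (Real.exp R)⁻¹ ≠ 0 := by linarith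
    have : 1 - (Real.exp R)⁻¹ ≠ 0 := by linarith
    have : 1 - (Real.exp (b * R))⁻¹ ≠ 0 := by linarith
    field_simp
    ring
  rw [hΨ']
  refine (norm_add_le _ _).trans (add_le_add ?_ ((norm_add_le _ _).trans (add_le_add ?_ ?_)))
  · rw [norm_div, norm_mul, norm_mul, hX]
    have : 0 < (Real.exp (b * R) - 1) * (Real.exp R - ‖x‖) :=
      mul_pos (by linarith) (by linarith)
    refine div_le_div_of_nonneg_left (by positivity) this ?_
    exact mul_le_mul n3 n1 (by linarith) (norm_nonneg _)
  · rw [norm_neg, norm_mul, norm_div]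
    have : 0 < Real.exp R - ‖x‖ := by linarith
    gcongr
  · rw [norm_mul, norm_div, norm_one]
    have : 0 < Real.exp R - 1 := by linarith
    gcongr

/-- Here `exp τ → 0`, and every term of the integrand carries that factor. -/
lemma tendsto_left_side {b : ℝ} (hb0 : 0 < b) (hb1 : b < 1) {τ₀ : ℂ}
    (hτ₀ : |τ₀.im| < Real.pi) :
    Tendsto (fun R : ℝ => ∫ y in (-Real.pi)..Real.pi,
      expRatioIntegrand b τ₀ ((-R : ℝ) + y * I)) atTop (𝓝 0) := by
  set x := exp τ₀ with hx
  have hx0 : 0 < ‖x‖ := norm_pos_iff.2 (exp_ne_zero _)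
  set A := ‖expRatio b τ₀‖
  set B := ‖expRatio b 0‖
  have hδ : Tendsto (fun R : ℝ => Real.exp (-R)) atTop (𝓝 0) :=
    Real.tendsto_exp_neg_atTop_nhds_zero
  have hη := tendsto_exp_neg_mul hb0
  set Ψ : ℝ × ℝ → ℝ := fun p => p.1 * ‖x - 1‖ / ((1 - p.2) * (‖x‖ - p.1)) +
    A * p.1 / (‖x‖ - p.1) + B * p.1 / (1 - p.1) with hΨ
  have hc : Tendsto Ψ (𝓝 (0, 0)) (𝓝 0) := by
    have : ContinuousAt Ψ (0, 0) := by
      simp only [hΨ]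
      refine ((ContinuousAt.div ?_ ?_ (by simp [hx0.ne'])).add
        (.div ?_ ?_ (by simp [hx0.ne']))).add (.div ?_ ?_ (by simp)) <;> fun_prop
    have h2 := this.tendsto
    simpa [hΨ] using h2
  have hδη : Tendsto (fun R : ℝ => (Real.exp (-R), Real.exp (-(b * R)))) atTop (𝓝 (0, 0)) :=
    hδ.prodMk_nhds hη
  have main := tendsto_integral_vertical (F := expRatioIntegrand b τ₀) (X := fun R => -R) (c := 0)
    (hc.comp hδη) ?_ (fun R => intervalIntegrable_vertical hb0 hb1 hτ₀ (-R))
  · simpa using main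
  filter_upwards [hδ.eventually_lt_const hx0, hδ.eventually_lt_const one_pos,
    hη.eventually_lt_const one_pos] with R k1 k2 k3 y
  have hX := norm_exp_add_mul_I (-R) y
  have hY := norm_exp_mul_add_mul_I b (-R) y
  rw [mul_neg] at hY
  set τ : ℂ := ((-R : ℝ) : ℂ) + y * I
  have n1 : ‖x‖ - Real.exp (-R) ≤ ‖exp τ - x‖ := by
    rw [norm_sub_rev, ← hX]; exact norm_sub_norm_le _ _
  have n2 : 1 - Real.exp (-R) ≤ ‖exp τ - 1‖ := by
    have := norm_sub_norm_le 1 (exp τ)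
    rwa [hX, norm_one, norm_sub_rev] at this
  have n3 : 1 - Real.exp (-(b * R)) ≤ ‖exp (b * τ) - 1‖ := by
    have := norm_sub_norm_le 1 (exp (b * τ))
    rwa [hY, norm_one, norm_sub_rev] at this
  have z1 : exp τ - x ≠ 0 := norm_pos_iff.1 (by linarith)
  have z2 : exp τ - 1 ≠ 0 := norm_pos_iff.1 (by linarith)
  have z3 : exp (b * τ) - 1 ≠ 0 := norm_pos_iff.1 (by linarith)
  rw [expRatioIntegrand_eq hb0.ne' (sub_ne_zero.1 z1) (sub_ne_zero.1 z2) (sub_ne_zero.1 z3),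
    sub_zero]
  refine (norm_add_le _ _).trans (add_le_add ((norm_sub_le _ _).trans (add_le_add ?_ ?_)) ?_)
  · rw [norm_div, norm_mul, norm_mul, hX]
    have : 0 < (1 - Real.exp (-(b * R))) * (‖x‖ - Real.exp (-R)) :=
      mul_pos (by linarith) (by linarith)
    refine div_le_div_of_nonneg_left (by positivity) this ?_
    exact mul_le_mul n3 n1 (by linarith) (norm_nonneg _)
  · rw [norm_div, norm_mul, hX]
    have : 0 < ‖x‖ - Real.exp (-R) := by linarith
    gcongr
  · rw [norm_div, norm_mul, hX]
    have : 0 < 1 - Real.exp (-R) := by linarith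
    gcongr

/-- Cauchy's theorem on the rectangle `[-R, R] × [-π, π]`: the horizontal sides give the density
integral, and the vertical sides give the limit. A limit over symmetric intervals suffices, so
integrability over the whole line is never needed. -/
theorem tendsto_integral_expRatioDensity {b : ℝ} (hb0 : 0 < b) (hb1 : b < 1) {τ₀ : ℂ}
    (hτ₀ : |τ₀.im| < Real.pi) :
    Tendsto (fun R : ℝ => ∫ s in (-R)..R,
        (expRatioDensity b s : ℂ) * ((exp τ₀ - 1) / (exp τ₀ + exp s)))
      atTop (𝓝 (expRatio b τ₀ - expRatio b 0)) := by
  have hpi := Real.pi_pos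
  have hpi' : (Real.pi : ℂ) ≠ 0 := by exact_mod_cast Real.pi_ne_zero
  have hlim := ((tendsto_left_side hb0 hb1 hτ₀).sub (tendsto_right_side hb0 hb1 hτ₀)).const_mul
    (1 / (2 * Real.pi) : ℂ)
  have e0 : (1 / (2 * Real.pi) : ℂ) * (0 - 2 * Real.pi * (expRatio b 0 - expRatio b τ₀)) =
      expRatio b τ₀ - expRatio b 0 := by
    field_simp; ring
  rw [e0] at hlim
  refine hlim.congr fun R => ?_
  have hrect := integral_boundary_rect_eq_zero_of_differentiableOn (expRatioIntegrand b τ₀)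
    (⟨-R, -Real.pi⟩ : ℂ) (⟨R, Real.pi⟩ : ℂ)
    ((differentiableOn_expRatioIntegrand hb0 hb1 hτ₀).mono fun τ hτ => by
      have := hτ.2
      simp only [mem_preimage, uIcc_of_le (by linarith : -Real.pi ≤ Real.pi)] at this
      simpa [abs_le] using this)
  simp only [smul_eq_mul] at hrect
  rw [← intervalIntegral.integral_sub
    (intervalIntegrable_horizontal hb0 hb1 hτ₀ (by rw [abs_neg, abs_of_pos hpi]) _ _)
    (intervalIntegrable_horizontal hb0 hb1 hτ₀ (by rw [abs_of_pos hpi]) _ _)] at hrect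
  simp only [expRatioIntegrand_jump hb0 hb1 hτ₀] at hrect
  rw [intervalIntegral.integral_const_mul] at hrect
  have hI : (2 * Real.pi * I : ℂ) ≠ 0 := by simp [hpi']
  refine mul_left_cancel₀ hI ?_
  have e1 : (2 * Real.pi * I : ℂ) * (1 / (2 * Real.pi) * ((∫ y in (-Real.pi)..Real.pi,
      expRatioIntegrand b τ₀ ((-R : ℝ) + y * I)) - ∫ y in (-Real.pi)..Real.pi,
      expRatioIntegrand b τ₀ ((R : ℝ) + y * I))) = I * (∫ y in (-Real.pi)..Real.pi,
      expRatioIntegrand b τ₀ ((-R : ℝ) + y * I)) - I * ∫ y in (-Real.pi)..Real.pi,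
      expRatioIntegrand b τ₀ ((R : ℝ) + y * I) := by
    field_simp
  rw [e1]
  linear_combination -hrect

/-! ### The unit disk and the quotient `f(z)/z`. -/

lemma mem_unitBall {z : ℂ} : z ∈ Metric.ball (0 : ℂ) 1 ↔ ‖z‖ < 1 := by simp

lemma one_sub_re_pos {z : ℂ} (hz : ‖z‖ < 1) : 0 < (1 - z).re := by
  have := (abs_le.1 (abs_re_le_norm z)).2
  simp only [sub_re, one_re]
  linarith

lemma one_sub_mem_slitPlane {z : ℂ} (hz : ‖z‖ < 1) : 1 - z ∈ slitPlane :=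
  Or.inl (one_sub_re_pos hz)

lemma one_sub_ne_zero {z : ℂ} (hz : ‖z‖ < 1) : 1 - z ≠ 0 :=
  slitPlane_ne_zero (one_sub_mem_slitPlane hz)

lemma overId_mul {f : ℂ → ℂ} (h0 : f 0 = 0) (z : ℂ) : overId f z * z = f z := by
  unfold overId
  split_ifs with h
  · simp [h, h0]
  · field_simp

lemma overId_eq_dslope {f : ℂ → ℂ} (h0 : f 0 = 0) : overId f = dslope f 0 := by
  ext z
  unfold overId
  split_ifs with h
  · simp [h]
  · simp [dslope_of_ne _ h, slope_def_field, h0]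

lemma differentiableOn_overId {f : ℂ → ℂ} (h0 : f 0 = 0)
    (hf : DifferentiableOn ℂ f (Metric.ball 0 1)) :
    DifferentiableOn ℂ (overId f) (Metric.ball 0 1) := by
  rw [overId_eq_dslope h0]
  exact (differentiableOn_dslope (Metric.ball_mem_nhds 0 one_pos)).2 hf

lemma mul_deriv_overId {f : ℂ → ℂ} (h0 : f 0 = 0)
    (hf : DifferentiableOn ℂ f (Metric.ball 0 1)) {z : ℂ} (hz : ‖z‖ < 1) :
    z * deriv (overId f) z = deriv f z - overId f z := by
  have hF := (differentiableOn_overId h0 hf).differentiableAt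
    (Metric.isOpen_ball.mem_nhds (mem_unitBall.2 hz))
  have h := hF.hasDerivAt.mul (hasDerivAt_id z)
  have e : overId f * id = f := funext fun z => overId_mul h0 z
  rw [e] at h
  rw [h.deriv]
  simp
  ring

/-! ### The extremal function `f_α`. -/

/-- The derivative of `f_α`. -/
lemma hasDerivAt_fAlpha (α : ℝ) {z : ℂ} (hz : ‖z‖ < 1) :
    HasDerivAt (fAlpha α) ((1 - z) ^ ((2 * α - 2 : ℝ) : ℂ)) z := by
  have hs := one_sub_mem_slitPlane hz
  have hn := one_sub_ne_zero hz
  have hd : HasDerivAt (fun z : ℂ => 1 - z) (-1) z := by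
    simpa using (hasDerivAt_id z).const_sub 1
  unfold fAlpha
  split_ifs with h
  · have e : ((2 * α - 2 : ℝ) : ℂ) = -1 := by rw [h]; push_cast; norm_num
    rw [e, cpow_neg_one]
    refine (hd.clog hs).neg.congr_deriv ?_
    rw [neg_div, neg_neg, one_div]
  · have hα : (2 * (α : ℂ) - 1) ≠ 0 := by
      intro h2
      apply h
      have : 2 * α - 1 = 0 := by exact_mod_cast h2
      linarith
    have h1 := ((hd.cpow_const (c := 2 * (α : ℂ) - 1) hs).const_sub 1).div_const (2 * (α : ℂ) - 1)
    refine h1.congr_deriv ?_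
    have e : (2 * (α : ℂ) - 1 - 1) = ((2 * α - 2 : ℝ) : ℂ) := by push_cast; ring
    rw [e]
    field_simp

lemma deriv_fAlpha (α : ℝ) {z : ℂ} (hz : ‖z‖ < 1) :
    deriv (fAlpha α) z = (1 - z) ^ ((2 * α - 2 : ℝ) : ℂ) :=
  (hasDerivAt_fAlpha α hz).deriv

lemma fAlpha_zero (α : ℝ) : fAlpha α 0 = 0 := by
  unfold fAlpha
  split_ifs <;> simp

lemma differentiableOn_fAlpha (α : ℝ) : DifferentiableOn ℂ (fAlpha α) (Metric.ball 0 1) :=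
  fun _ hz => (hasDerivAt_fAlpha α (mem_unitBall.1 hz)).differentiableAt.differentiableWithinAt

lemma norm_ofReal_mul_lt {t : ℝ} (h0 : 0 ≤ t) (h1 : t ≤ 1) {z : ℂ} (hz : ‖z‖ < 1) :
    ‖(t : ℂ) * z‖ < 1 := by
  rw [norm_mul, norm_real, Real.norm_of_nonneg h0]
  nlinarith [norm_nonneg z]

lemma continuousOn_deriv_fAlpha_ray (α : ℝ) {z : ℂ} (hz : ‖z‖ < 1) :
    ContinuousOn (fun t : ℝ => (1 - (t : ℂ) * z) ^ ((2 * α - 2 : ℝ) : ℂ)) (Icc 0 1) := by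
  intro t ht
  refine ContinuousAt.continuousWithinAt ?_
  refine ContinuousAt.cpow (by fun_prop) (by fun_prop) ?_
  exact one_sub_mem_slitPlane (norm_ofReal_mul_lt ht.1 ht.2 hz)

/-- Averaging `f_α'` over the segment `[0, z]` treats all `α` uniformly and makes the sign of the
imaginary part visible. -/
lemma overId_fAlpha_eq_integral (α : ℝ) {z : ℂ} (hz : ‖z‖ < 1) :
    overId (fAlpha α) z = ∫ t in (0 : ℝ)..1, (1 - (t : ℂ) * z) ^ ((2 * α - 2 : ℝ) : ℂ) := by
  by_cases h : z = 0
  · subst h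
    simp [overId, deriv_fAlpha α hz]
  · have hd : ∀ t ∈ uIcc (0 : ℝ) 1, HasDerivAt (fun t : ℝ => fAlpha α (t * z) / z)
        ((1 - (t : ℂ) * z) ^ ((2 * α - 2 : ℝ) : ℂ)) t := by
      intro t ht
      rw [uIcc_of_le zero_le_one] at ht
      have h1 := hasDerivAt_fAlpha α (norm_ofReal_mul_lt ht.1 ht.2 hz)
      have h2 : HasDerivAt (fun t : ℝ => (t : ℂ) * z) z t := by
        simpa using (hasDerivAt_id t).ofReal_comp.mul_const z
      have h3 := (h1.comp t h2).div_const z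
      rwa [mul_div_cancel_right₀ _ h] at h3
    rw [intervalIntegral.integral_eq_sub_of_hasDerivAt hd]
    · simp [overId, h, fAlpha_zero]
    · apply ContinuousOn.intervalIntegrable
      rw [uIcc_of_le zero_le_one]
      exact continuousOn_deriv_fAlpha_ray α hz

/-- For `Im z > 0` the argument of `1 - t z` lies in `(-π/2, 0)`; the exponent `2α - 2` lies in
`[-2, 0)`, so the integrand has argument in `(0, π)`. -/
lemma overId_fAlpha_im_pos {α : ℝ} (h0 : 0 ≤ α) (h1 : α < 1) {z : ℂ} (hz : ‖z‖ < 1)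
    (hi : 0 < z.im) : 0 < (overId (fAlpha α) z).im := by
  have hc := continuousOn_deriv_fAlpha_ray α hz
  have hii : IntervalIntegrable (fun t : ℝ => (1 - (t : ℂ) * z) ^ ((2 * α - 2 : ℝ) : ℂ))
      MeasureTheory.volume 0 1 := by
    apply ContinuousOn.intervalIntegrable
    rwa [uIcc_of_le zero_le_one]
  rw [overId_fAlpha_eq_integral α hz, ← imCLM_apply, ← imCLM.intervalIntegral_comp_comm hii]
  refine intervalIntegral.intervalIntegral_pos_of_pos_on ?_ ?_ one_pos
  · exact ((imCLM.continuous.comp_continuousOn (uIcc_of_le (zero_le_one (α := ℝ)) ▸ hc)).intervalIntegrable)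
  · intro t ht
    have hz' := norm_ofReal_mul_lt ht.1.le ht.2.le hz
    have hre := one_sub_re_pos hz'
    have him : (1 - (t : ℂ) * z).im < 0 := by
      have := mul_pos ht.1 hi
      simpa using this
    have ha1 := arg_neg_iff.2 him
    have ha2 := (abs_lt.1 (abs_arg_lt_pi_div_two_iff.2 (Or.inl hre))).1
    rw [imCLM_apply, cpow_ofReal_im]
    refine mul_pos (Real.rpow_pos_of_pos (norm_pos_iff.2 (one_sub_ne_zero hz')) _)
      (Real.sin_pos_of_pos_of_lt_pi ?_ ?_) <;> nlinarith

lemma overId_fAlpha_conj (α : ℝ) {z : ℂ} (hz : ‖z‖ < 1) :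
    overId (fAlpha α) (conj z) = conj (overId (fAlpha α) z) := by
  have hz' : ‖conj z‖ < 1 := by rwa [norm_conj]
  rw [overId_fAlpha_eq_integral α hz, overId_fAlpha_eq_integral α hz',
    intervalIntegral.integral_of_le zero_le_one, intervalIntegral.integral_of_le zero_le_one,
    ← integral_conj]
  refine MeasureTheory.setIntegral_congr_fun measurableSet_Ioc fun t ht => ?_
  have hs := one_sub_mem_slitPlane (norm_ofReal_mul_lt ht.1.le ht.2 hz)
  have := conj_cpow (1 - (t : ℂ) * z) ((2 * α - 2 : ℝ) : ℂ) (slitPlane_arg_ne_pi hs)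
  simp only [conj_ofReal] at this
  simp only [← this]
  simp

lemma overId_fAlpha_im_neg {α : ℝ} (h0 : 0 ≤ α) (h1 : α < 1) {z : ℂ} (hz : ‖z‖ < 1)
    (hi : z.im < 0) : (overId (fAlpha α) z).im < 0 := by
  have := overId_fAlpha_im_pos h0 h1 (z := conj z) (by rwa [norm_conj]) (by simpa using hi)
  rw [overId_fAlpha_conj α hz, conj_im] at this
  linarith

lemma overId_fAlpha_ofReal (α : ℝ) {t : ℝ} (ht : |t| < 1) :
    0 < (overId (fAlpha α) t).re ∧ (overId (fAlpha α) t).im = 0 := by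
  have hz : ‖(t : ℂ)‖ < 1 := by simpa using ht
  have hc := continuousOn_deriv_fAlpha_ray α hz
  have hii : IntervalIntegrable (fun s : ℝ => (1 - (s : ℂ) * t) ^ ((2 * α - 2 : ℝ) : ℂ))
      MeasureTheory.volume 0 1 := by
    apply ContinuousOn.intervalIntegrable
    rwa [uIcc_of_le zero_le_one]
  constructor
  · rw [overId_fAlpha_eq_integral α hz, ← reCLM_apply, ← reCLM.intervalIntegral_comp_comm hii]
    refine intervalIntegral.intervalIntegral_pos_of_pos_on ((reCLM.continuous.comp_continuousOn (uIcc_of_le (zero_le_one (α := ℝ)) ▸ hc)).intervalIntegrable)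
      ?_ one_pos
    intro s hs
    have h1 := one_sub_re_pos (norm_ofReal_mul_lt hs.1.le hs.2.le hz)
    have e : (1 - (s : ℂ) * t) = ((1 - s * t : ℝ) : ℂ) := by push_cast; rfl
    rw [e, ofReal_re] at h1
    rw [e, ← ofReal_cpow h1.le, reCLM_apply, ofReal_re]
    exact Real.rpow_pos_of_pos h1 _
  · have := overId_fAlpha_conj α hz
    rw [conj_ofReal] at this
    exact conj_eq_iff_im.1 this.symm

/-- This makes the principal logarithm of `f_α(z)/z` analytic on the whole disk. -/
lemma overId_fAlpha_mem_slitPlane {α : ℝ} (h0 : 0 ≤ α) (h1 : α < 1) {z : ℂ} (hz : ‖z‖ < 1) :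
    overId (fAlpha α) z ∈ slitPlane := by
  rcases lt_trichotomy z.im 0 with h | h | h
  · exact Or.inr (overId_fAlpha_im_neg h0 h1 hz h).ne
  · have e : z = (z.re : ℂ) := Complex.ext (by simp) (by simp [h])
    rw [e] at hz ⊢
    exact Or.inl (overId_fAlpha_ofReal α (by simpa using hz)).1
  · exact Or.inr (overId_fAlpha_im_pos h0 h1 hz h).ne'

lemma fAlpha_ne_zero {α : ℝ} (h0 : 0 ≤ α) (h1 : α < 1) {z : ℂ} (hz : ‖z‖ < 1) (hz0 : z ≠ 0) :
    fAlpha α z ≠ 0 := by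
  rw [← overId_mul (fAlpha_zero α)]
  exact mul_ne_zero (slitPlane_ne_zero (overId_fAlpha_mem_slitPlane h0 h1 hz)) hz0

/-! ### The function `q_α` as the quotient `z f_α' / f_α`. -/

lemma qAlpha_eq_div {α : ℝ} (h0 : 0 ≤ α) (h1 : α < 1) {z : ℂ} (hz : ‖z‖ < 1) :
    qAlpha α z = deriv (fAlpha α) z / overId (fAlpha α) z := by
  by_cases hz0 : z = 0
  · subst hz0
    simp [qAlpha, overId, deriv_fAlpha α hz]
  · have hf := fAlpha_ne_zero h0 h1 hz hz0
    have hu := one_sub_ne_zero hz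
    rw [deriv_fAlpha α hz]
    simp only [qAlpha, overId, hz0, if_false]
    by_cases h : α = 1 / 2
    · have e : ((2 * α - 2 : ℝ) : ℂ) = -1 := by rw [h]; push_cast; norm_num
      simp only [fAlpha, h, if_true] at hf ⊢
      have e : ((2 * (1 / 2) - 2 : ℝ) : ℂ) = -1 := by push_cast; norm_num
      rw [e, cpow_neg_one]
      have hl : Complex.log (1 - z) ≠ 0 := by simpa using hf
      field_simp
    · have hα : (2 * (α : ℂ) - 1) ≠ 0 := by
        intro h2
        apply h
        have : 2 * α - 1 = 0 := by exact_mod_cast h2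
        linarith
      simp only [fAlpha, h, if_false] at hf ⊢
      have e1 : (1 - z) ^ ((2 * α - 2 : ℝ) : ℂ) =
          (1 - z) ^ (2 * (α : ℂ) - 1) / (1 - z) := by
        have : ((2 * α - 2 : ℝ) : ℂ) = 2 * (α : ℂ) - 1 - 1 := by push_cast; ring
        rw [this, cpow_sub _ _ hu, cpow_one]
      have e2 : (1 - z) ^ (1 - 2 * (α : ℂ)) = ((1 - z) ^ (2 * (α : ℂ) - 1))⁻¹ := by
        rw [← cpow_neg]; congr 1; ring
      have hY : (1 - z) ^ (2 * (α : ℂ) - 1) ≠ 0 := by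
        simp [cpow_eq_zero_iff, hu]
      rw [e1, e2]
      generalize (1 - z) ^ (2 * (α : ℂ) - 1) = Y at *
      have h3 : 1 - Y ≠ 0 := fun h4 => hf (by rw [h4, zero_div])
      have h4 : 1 - Y⁻¹ ≠ 0 := by
        intro h5
        apply h3
        have : Y⁻¹ = 1 := (sub_eq_zero.1 h5).symm
        rw [inv_eq_one.1 this, sub_self]
      have h5 : Y - 1 ≠ 0 := by
        intro h6; apply h3; linear_combination -h6
      field_simp
      ring

lemma differentiableOn_qAlpha {α : ℝ} (h0 : 0 ≤ α) (h1 : α < 1) :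
    DifferentiableOn ℂ (qAlpha α) (Metric.ball 0 1) := by
  have h := ((differentiableOn_fAlpha α).deriv Metric.isOpen_ball).div
    (differentiableOn_overId (fAlpha_zero α) (differentiableOn_fAlpha α))
    (fun z hz => slitPlane_ne_zero (overId_fAlpha_mem_slitPlane h0 h1 (mem_unitBall.1 hz)))
  exact h.congr fun z hz => qAlpha_eq_div h0 h1 (mem_unitBall.1 hz)

lemma qAlpha_zero (α : ℝ) : qAlpha α 0 = 1 := by simp [qAlpha]

lemma qAlpha_conj {α : ℝ} (h0 : 0 ≤ α) (h1 : α < 1) {z : ℂ} (hz : ‖z‖ < 1) :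
    qAlpha α (conj z) = conj (qAlpha α z) := by
  have hz' : ‖conj z‖ < 1 := by rwa [norm_conj]
  rw [qAlpha_eq_div h0 h1 hz, qAlpha_eq_div h0 h1 hz', overId_fAlpha_conj α hz, map_div₀,
    deriv_fAlpha α hz, deriv_fAlpha α hz']
  congr 1
  have := conj_cpow (1 - z) ((2 * α - 2 : ℝ) : ℂ) (slitPlane_arg_ne_pi (one_sub_mem_slitPlane hz))
  simp only [conj_ofReal] at this
  rw [← this]
  simp

lemma qAlpha_im_ofReal {α : ℝ} (h0 : 0 ≤ α) (h1 : α < 1) {t : ℝ} (ht : |t| < 1) :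
    (qAlpha α t).im = 0 := by
  have := qAlpha_conj h0 h1 (z := (t : ℂ)) (by simpa using ht)
  rw [conj_ofReal] at this
  exact conj_eq_iff_im.1 this.symm

/-! ### Circle monotonicity of `q_α`. -/

lemma expRatio_neg_log {b : ℝ} (hb : b ≠ 0) {z : ℂ} (hz : ‖z‖ < 1) (hz0 : z ≠ 0) :
    expRatio b (-log (1 - z)) = z / ((1 - z) * ((1 - z) ^ (-(b : ℂ)) - 1)) := by
  have hu := one_sub_ne_zero hz
  have hl : -log (1 - z) ≠ 0 := by
    intro h
    have h1 := exp_log hu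
    rw [neg_eq_zero.1 h, exp_zero] at h1
    apply hz0
    linear_combination h1
  rw [expRatio_of_ne hb hl, exp_neg, exp_log hu, cpow_def_of_ne_zero hu]
  rw [show (b : ℂ) * -log (1 - z) = log (1 - z) * -b by ring, ← div_div]
  congr 1
  field_simp
  ring

/-- With `x = 1 / (1 - z)`, the quotient `(x - 1) / (x + exp s)` is the kernel with `A = 1 + exp s`
and `B = exp s`. -/
lemma circleMonotone_expRatio {b : ℝ} (hb0 : 0 < b) (hb1 : b < 1) :
    CircleMonotone (fun z => expRatio b (-log (1 - z))) := by
  refine CircleMonotone.of_tendsto (l := atTop) (G := fun (R : ℝ) z => ((1 / b : ℝ) : ℂ) +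
    ∫ s in (-R)..R, (expRatioDensity b s : ℂ) *
      (z / ((1 + Real.exp s : ℝ) - (Real.exp s : ℝ) * z))) ?_ ?_
  · filter_upwards [eventually_ge_atTop 0] with R hR
    refine (CircleMonotone.const (by positivity)).add
      (CircleMonotone.intervalIntegral (by linarith) (fun s => ?_) fun z hz => ?_)
    · have := Real.exp_pos s
      exact (CircleMonotone.kernel this.le (by linarith) (by linarith)).const_mul
        (expRatioDensity_nonneg hb0 hb1 s)
    · refine (continuous_ofReal.comp (continuous_expRatioDensity hb0 hb1)).mul
        (Continuous.div (by fun_prop) (by fun_prop) fun s => ?_)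
      have := Real.exp_pos s
      exact CircleMonotone.kernel_denominator_ne_zero this.le (by linarith) (by linarith) hz
  · intro z hz
    have hu := one_sub_ne_zero hz
    have ha : |(-log (1 - z)).im| < Real.pi := by
      have := abs_arg_lt_pi_div_two_iff.2 (Or.inl (one_sub_re_pos hz))
      simp only [neg_im, log_im, abs_neg]
      linarith [Real.pi_pos]
    have h := (tendsto_integral_expRatioDensity hb0 hb1 ha).const_add ((1 / b : ℝ) : ℂ)
    have e : ((1 / b : ℝ) : ℂ) + (expRatio b (-log (1 - z)) - expRatio b 0) =
        expRatio b (-log (1 - z)) := by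
      rw [expRatio_zero]; push_cast; ring
    rw [e] at h
    refine h.congr fun R => ?_
    congr 1
    refine intervalIntegral.integral_congr fun s _ => ?_
    have := Real.exp_pos s
    have hD := CircleMonotone.kernel_denominator_ne_zero this.le
      (by linarith : Real.exp s ≤ 1 + Real.exp s) (by linarith) hz
    simp only [exp_neg, exp_log hu]
    congr 1
    push_cast at hD ⊢
    have hD' : (1 - z)⁻¹ + exp s ≠ 0 := by
      intro h0
      apply hD
      have : (1 - z) * ((1 - z)⁻¹ + exp s) = 0 := by rw [h0, mul_zero]
      rw [mul_add, mul_inv_cancel₀ hu] at this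
      linear_combination this
    have hD2 : 1 + (1 - z) * exp s ≠ 0 := by
      intro h0; apply hD; linear_combination h0
    rw [div_eq_div_iff hD' hD]
    field_simp
    ring

lemma circleMonotone_qAlpha_of_gt {α : ℝ} (h0 : 1 / 2 < α) (h1 : α < 1) :
    CircleMonotone (qAlpha α) := by
  have hb0 : 0 < 2 * α - 1 := by linarith
  refine ((circleMonotone_expRatio hb0 (by linarith)).const_mul hb0.le).congr fun z hz => ?_
  by_cases hz0 : z = 0
  · have : ((2 * α - 1 : ℝ) : ℂ) ≠ 0 := by exact_mod_cast hb0.ne'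
    simp [hz0, qAlpha, expRatio_zero]
    push_cast at this
    field_simp
  · rw [expRatio_neg_log hb0.ne' hz hz0]
    simp only [qAlpha, hz0, if_false, h0.ne']
    have e : -((2 * α - 1 : ℝ) : ℂ) = 1 - 2 * (α : ℂ) := by push_cast; ring
    rw [e, show 1 - (1 - z) ^ (1 - 2 * (α : ℂ)) = -((1 - z) ^ (1 - 2 * (α : ℂ)) - 1) by ring,
      mul_neg, div_neg]
    push_cast
    ring

lemma circleMonotone_div_one_sub {b : ℝ} (hb : 0 ≤ b) :
    CircleMonotone (fun z => (b : ℂ) * (z / (1 - z))) := by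
  have := (CircleMonotone.kernel zero_le_one le_rfl one_pos).const_mul hb
  simpa using this

/-- Put `b = 1 - 2α` and `Y = (1 - z) ^ (-b)`. From `1 / (1 - Y⁻¹) = 1 + 1 / (Y - 1)` one gets `b *
expRatio b` plus the boundary kernel `b z / (1 - z)`. The value `α = 0` is separate because there `b
= 1`. -/
lemma circleMonotone_qAlpha_of_lt {α : ℝ} (h0 : 0 ≤ α) (h1 : α < 1 / 2) :
    CircleMonotone (qAlpha α) := by
  rcases h0.eq_or_lt with rfl | h0
  · refine ((CircleMonotone.const zero_le_one).add
      (circleMonotone_div_one_sub zero_le_one)).congr fun z hz => ?_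
    have hu := one_sub_ne_zero hz
    by_cases hz0 : z = 0
    · simp [hz0, qAlpha]
    · simp [hz0, qAlpha]
      field_simp
      ring
  · have hb0 : 0 < 1 - 2 * α := by linarith
    refine (((circleMonotone_expRatio hb0 (by linarith)).const_mul hb0.le).add
      (circleMonotone_div_one_sub hb0.le)).congr fun z hz => ?_
    have hu := one_sub_ne_zero hz
    by_cases hz0 : z = 0
    · have : ((1 - 2 * α : ℝ) : ℂ) ≠ 0 := by exact_mod_cast hb0.ne'
      simp [hz0, qAlpha, expRatio_zero]
      push_cast at this
      field_simp
    · rw [expRatio_neg_log hb0.ne' hz hz0]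
      have hf := fAlpha_ne_zero h0.le (by linarith) hz hz0
      simp only [fAlpha, h1.ne, if_false] at hf
      simp only [qAlpha, hz0, if_false, h1.ne]
      have e : (1 - 2 * (α : ℂ)) = ((1 - 2 * α : ℝ) : ℂ) := by push_cast; rfl
      have e2 : (2 * (α : ℂ) - 1) = -((1 - 2 * α : ℝ) : ℂ) := by push_cast; ring
      have hY : (1 - z) ^ (-((1 - 2 * α : ℝ) : ℂ)) ≠ 0 := by
        simp [cpow_eq_zero_iff, hu]
      have e3 : (1 - z) ^ ((1 - 2 * α : ℝ) : ℂ) = ((1 - z) ^ (-((1 - 2 * α : ℝ) : ℂ)))⁻¹ := by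
        rw [← cpow_neg]; congr 1; ring
      rw [e2] at hf
      rw [e, e3]
      generalize (1 - z) ^ (-((1 - 2 * α : ℝ) : ℂ)) = Y at *
      generalize ((1 - 2 * α : ℝ) : ℂ) = b at *
      have h3 : Y - 1 ≠ 0 := by
        intro h4; apply hf
        rw [show 1 - Y = 0 by linear_combination -h4, zero_div]
      have h4 : 1 - Y⁻¹ ≠ 0 := by
        intro h5
        apply h3
        rw [inv_eq_one.1 (sub_eq_zero.1 h5).symm, sub_self]
      field_simp
      ring

/-- The limit `b → 0+` of `b * expRatio b`, since `((1 - z) ^ (-b) - 1) / b` tends to `-log (1 -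
z)`. -/
lemma circleMonotone_qAlpha_half : CircleMonotone (qAlpha (1 / 2)) := by
  refine CircleMonotone.of_tendsto (l := 𝓝[>] (0 : ℝ))
    (G := fun b z => (b : ℂ) * expRatio b (-log (1 - z))) ?_ ?_
  · have : ∀ᶠ b : ℝ in 𝓝[>] 0, b ∈ Ioo (0 : ℝ) 1 := Ioo_mem_nhdsGT one_pos
    filter_upwards [this] with b hb
    exact (circleMonotone_expRatio hb.1 hb.2).const_mul hb.1.le
  · intro z hz
    have hu := one_sub_ne_zero hz
    have hpos : ∀ᶠ b : ℝ in 𝓝[>] 0, 0 < b := eventually_mem_nhdsWithin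
    by_cases hz0 : z = 0
    · refine tendsto_const_nhds.congr' ?_
      filter_upwards [hpos] with b hb
      have : (b : ℂ) ≠ 0 := by exact_mod_cast hb.ne'
      simp [hz0, qAlpha, expRatio_zero, this]
    · have hf := fAlpha_ne_zero (α := 1 / 2) (by norm_num) (by norm_num) hz hz0
      simp only [fAlpha, if_true] at hf
      have hd : HasDerivAt (fun b : ℝ => (1 - z) ^ (-(b : ℂ))) (-log (1 - z)) 0 := by
        have h1 := (hasDerivAt_neg ((0 : ℝ) : ℂ)).const_cpow (c := 1 - z) (Or.inl hu)
        have h2 := h1.comp_ofReal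
        refine h2.congr_deriv ?_
        simp
      have hs := hd.tendsto_slope_zero_right
      simp only [zero_add, ofReal_zero, neg_zero, cpow_zero] at hs
      have ht := (hs.const_mul (1 - z)).inv₀ (mul_ne_zero hu hf) |>.const_mul z
      have e : z * ((1 - z) * -log (1 - z))⁻¹ = qAlpha (1 / 2) z := by
        simp only [qAlpha, hz0, if_false, if_true]
        rw [mul_neg, inv_neg, div_eq_mul_inv]
        ring
      rw [e] at ht
      refine ht.congr' ?_
      filter_upwards [hpos] with b hb
      have hb' : (b : ℂ) ≠ 0 := by exact_mod_cast hb.ne'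
      rw [expRatio_neg_log hb.ne' hz hz0, real_smul, ofReal_inv]
      rw [mul_inv, mul_inv, inv_inv, ← mul_div_assoc, div_eq_mul_inv, mul_inv]
      ring

theorem circleMonotone_qAlpha {α : ℝ} (h0 : 0 ≤ α) (h1 : α < 1) : CircleMonotone (qAlpha α) := by
  rcases lt_trichotomy α (1 / 2) with h | rfl | h
  · exact circleMonotone_qAlpha_of_lt h0 h
  · exact circleMonotone_qAlpha_half
  · exact circleMonotone_qAlpha_of_gt h h1

/-! ### Strictness from the identity theorem, and the extremes of `q_α` on disks. -/

lemma analyticOnNhd_qAlpha {α : ℝ} (h0 : 0 ≤ α) (h1 : α < 1) :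
    AnalyticOnNhd ℂ (qAlpha α) (Metric.ball 0 1) :=
  (differentiableOn_qAlpha h0 h1).analyticOnNhd Metric.isOpen_ball

lemma isPreconnected_ball_zero (r : ℝ) : IsPreconnected (Metric.ball (0 : ℂ) r) :=
  (convex_ball _ _).isPreconnected

lemma deriv_deriv_fAlpha_ne_zero {α : ℝ} (h1 : α < 1) {z : ℂ} (hz : ‖z‖ < 1) :
    deriv (deriv (fAlpha α)) z ≠ 0 := by
  have e : deriv (fAlpha α) =ᶠ[𝓝 z] fun z => (1 - z) ^ ((2 * α - 2 : ℝ) : ℂ) := by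
    filter_upwards [Metric.isOpen_ball.mem_nhds (mem_unitBall.2 hz)] with w hw
    exact deriv_fAlpha α (mem_unitBall.1 hw)
  have hd : HasDerivAt (fun z : ℂ => 1 - z) (-1) z := by
    simpa using (hasDerivAt_id z).const_sub 1
  rw [e.deriv_eq,
    (hd.cpow_const (c := ((2 * α - 2 : ℝ) : ℂ)) (one_sub_mem_slitPlane hz)).deriv]
  have h2 : ((2 * α - 2 : ℝ) : ℂ) ≠ 0 := by exact_mod_cast (by linarith : 2 * α - 2 < 0).ne
  exact mul_ne_zero (mul_ne_zero h2 (by simp [cpow_eq_zero_iff, one_sub_ne_zero hz])) (by simp)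

/-- If `q_α ≡ 1` then `f_α' = f_α(z)/z`, which forces that quotient to be constant; but `f_α''` has
no zeros. -/
lemma exists_qAlpha_ne_one {α : ℝ} (h0 : 0 ≤ α) (h1 : α < 1) :
    ¬ EqOn (qAlpha α) 1 (Metric.ball 0 1) := by
  intro h
  have hF := differentiableOn_fAlpha α
  have e : ∀ z ∈ Metric.ball (0 : ℂ) 1, deriv (fAlpha α) z = overId (fAlpha α) z := by
    intro z hz
    have h2 := h hz
    rw [qAlpha_eq_div h0 h1 (mem_unitBall.1 hz)] at h2
    exact (div_eq_one_iff_eq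
      (slitPlane_ne_zero (overId_fAlpha_mem_slitPlane h0 h1 (mem_unitBall.1 hz)))).1 h2
  have hz : ‖(1 / 2 : ℂ)‖ < 1 := by norm_num
  have h3 := mul_deriv_overId (fAlpha_zero α) hF hz
  rw [e _ (mem_unitBall.2 hz), sub_self] at h3
  have e2 : deriv (fAlpha α) =ᶠ[𝓝 (1 / 2 : ℂ)] overId (fAlpha α) := by
    filter_upwards [Metric.isOpen_ball.mem_nhds (mem_unitBall.2 hz)] with w hw using e w hw
  rw [← e2.deriv_eq] at h3
  exact deriv_deriv_fAlpha_ne_zero h1 hz (by simpa using h3)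

lemma not_eventually_qAlpha_const {α : ℝ} (h0 : 0 ≤ α) (h1 : α < 1) {z₀ : ℂ} (hz₀ : ‖z₀‖ < 1)
    (c : ℂ) : ¬ ∃ᶠ z in 𝓝[≠] z₀, qAlpha α z = c := by
  intro h
  have h2 := (analyticOnNhd_qAlpha h0 h1).eqOn_of_preconnected_of_frequently_eq
    analyticOnNhd_const (isPreconnected_ball_zero 1) (mem_unitBall.2 hz₀) h
  have h3 : (1 : ℂ) = c := qAlpha_zero α ▸ h2 (mem_unitBall.2 (by simp))
  exact exists_qAlpha_ne_one h0 h1 fun z hz => by rw [h2 hz, ← h3]; rfl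

/-- Equality at two points would make `q_α`, real on the real axis, constant on a segment and hence
on the disk. -/
lemma qAlpha_strictMonoOn {α : ℝ} (h0 : 0 ≤ α) (h1 : α < 1) :
    StrictMonoOn (fun t : ℝ => (qAlpha α t).re) (Ioo (-1) 1) := by
  have hm := (circleMonotone_qAlpha h0 h1).monotone
  intro s hs t ht hst
  refine (hm hs ht hst.le).lt_of_ne fun he => ?_
  simp only at he
  obtain ⟨m, hm1, hm2⟩ := exists_between hst
  have hmem : ∀ u ∈ Ioo s t, u ∈ Ioo (-1 : ℝ) 1 := fun u hu =>
    ⟨hs.1.trans hu.1, hu.2.trans ht.2⟩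
  refine not_eventually_qAlpha_const h0 h1 (z₀ := m) (by simpa [abs_lt] using hmem m ⟨hm1, hm2⟩)
    ((qAlpha α s).re : ℂ) ?_
  have hc : Tendsto (fun u : ℝ => (u : ℂ)) (𝓝[≠] m) (𝓝[≠] (m : ℂ)) := by
    refine tendsto_nhdsWithin_of_tendsto_nhds_of_eventually_within _
      ((continuous_ofReal.tendsto m).mono_left nhdsWithin_le_nhds) ?_
    filter_upwards [self_mem_nhdsWithin] with u hu
    simpa using hu
  refine hc.frequently (Eventually.frequently ?_)
  filter_upwards [nhdsWithin_le_nhds (Ioo_mem_nhds hm1 hm2)] with u hu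
  have hu' := hmem u hu
  refine Complex.ext ?_ ?_
  · rw [ofReal_re]
    have a1 := hm hs hu' hu.1.le
    have a2 := hm hu' ht hu.2.le
    simp only at a1 a2
    linarith
  · rw [ofReal_im, qAlpha_im_ofReal h0 h1 (by simpa [abs_lt] using hu')]

lemma ofReal_mem_Ioo {ρ : ℝ} (h0 : 0 ≤ ρ) (h1 : ρ < 1) : ρ ∈ Ioo (-1 : ℝ) 1 :=
  ⟨by linarith, h1⟩

lemma neg_mem_Ioo {ρ : ℝ} (h0 : 0 ≤ ρ) (h1 : ρ < 1) : -ρ ∈ Ioo (-1 : ℝ) 1 :=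
  ⟨by linarith, by linarith⟩

lemma arg_mem_Icc_of_im_nonneg {z : ℂ} (hi : 0 ≤ z.im) : arg z ∈ Icc 0 Real.pi :=
  ⟨arg_nonneg_iff.2 hi, arg_le_pi z⟩

/-- The minimum over a circle sits at the end `φ = π` of the upper half-circle; conjugation covers
the lower one. -/
lemma qAlpha_re_ge_neg_norm {α : ℝ} (h0 : 0 ≤ α) (h1 : α < 1) {z : ℂ} (hz : ‖z‖ < 1) :
    (qAlpha α ((-‖z‖ : ℝ) : ℂ)).re ≤ (qAlpha α z).re := by
  wlog hi : 0 ≤ z.im generalizing z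
  · have := this (z := conj z) (by rwa [norm_conj]) (by simp at hi ⊢; linarith)
    rwa [norm_conj, qAlpha_conj h0 h1 hz, conj_re] at this
  have h := (circleMonotone_qAlpha h0 h1).antitone ‖z‖ (norm_nonneg z) hz
    (arg_mem_Icc_of_im_nonneg hi) ⟨Real.pi_pos.le, le_rfl⟩ (arg_le_pi z)
  simp only [norm_mul_exp_arg_mul_I, exp_pi_mul_I] at h
  push_cast
  rwa [mul_neg_one] at h

lemma qAlpha_re_ge {α : ℝ} (h0 : 0 ≤ α) (h1 : α < 1) {z : ℂ} {r : ℝ} (hz : ‖z‖ ≤ r)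
    (hr : r < 1) : (qAlpha α ((-r : ℝ) : ℂ)).re ≤ (qAlpha α z).re :=
  ((circleMonotone_qAlpha h0 h1).monotone (neg_mem_Ioo ((norm_nonneg z).trans hz) hr)
    (neg_mem_Ioo (norm_nonneg z) (hz.trans_lt hr)) (neg_le_neg hz)).trans
    (qAlpha_re_ge_neg_norm h0 h1 (hz.trans_lt hr))

lemma qAlpha_re_gt {α : ℝ} (h0 : 0 ≤ α) (h1 : α < 1) {z : ℂ} {r : ℝ} (hz : ‖z‖ < r)
    (hr : r < 1) : (qAlpha α ((-r : ℝ) : ℂ)).re < (qAlpha α z).re :=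
  (qAlpha_strictMonoOn h0 h1 (neg_mem_Ioo ((norm_nonneg z).trans hz.le) hr)
    (neg_mem_Ioo (norm_nonneg z) (hz.trans hr)) (neg_lt_neg hz)).trans_le
    (qAlpha_re_ge_neg_norm h0 h1 (hz.trans hr))

lemma norm_qAlpha_le {α : ℝ} (h0 : 0 ≤ α) (h1 : α < 1) {z : ℂ} {r : ℝ} (hz : ‖z‖ ≤ r)
    (hr : r < 1) : ‖qAlpha α z‖ ≤ (qAlpha α (r : ℂ)).re :=
  ((circleMonotone_qAlpha h0 h1).norm_le z (hz.trans_lt hr)).trans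
    ((circleMonotone_qAlpha h0 h1).monotone (ofReal_mem_Ioo (norm_nonneg z) (hz.trans_lt hr))
      (ofReal_mem_Ioo ((norm_nonneg z).trans hz) hr) hz)

lemma norm_qAlpha_lt {α : ℝ} (h0 : 0 ≤ α) (h1 : α < 1) {z : ℂ} {r : ℝ} (hz : ‖z‖ < r)
    (hr : r < 1) : ‖qAlpha α z‖ < (qAlpha α (r : ℂ)).re :=
  ((circleMonotone_qAlpha h0 h1).norm_le z (hz.trans hr)).trans_lt
    (qAlpha_strictMonoOn h0 h1 (ofReal_mem_Ioo (norm_nonneg z) (hz.trans hr))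
      (ofReal_mem_Ioo ((norm_nonneg z).trans hz.le) hr) hz)

/-! ### The part of the line `Re = 1` inside the image of a disk under `q_α`. -/

/-- The line `Re w = 1` meets the image of each open upper half-circle about `0` at most once. -/
lemma eq_of_qAlpha_re_eq_one {α : ℝ} (h0 : 0 ≤ α) (h1 : α < 1) {ρ : ℝ} (hρ0 : 0 < ρ) (hρ1 : ρ < 1)
    {s t : ℝ} (hs : s ∈ Icc 0 Real.pi) (ht : t ∈ Icc 0 Real.pi)
    (es : (qAlpha α (ρ * exp (s * I))).re = 1) (et : (qAlpha α (ρ * exp (t * I))).re = 1) :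
    s = t := by
  by_contra hne
  wlog hst : s < t generalizing s t
  · exact this ht hs et es (Ne.symm hne) (lt_of_le_of_ne (not_lt.1 hst) (Ne.symm hne))
  have ha := (circleMonotone_qAlpha h0 h1).antitone ρ hρ0.le hρ1
  set h : ℝ → ℝ := fun φ => (qAlpha α (ρ * exp (φ * I))).re with hh
  -- By monotonicity `h` equals `1` between `s` and `t`; real analyticity spreads this to `φ = 0`,
  -- where `Re q_α(ρ) > q_α(0) = 1`.
  have han : AnalyticOnNhd ℝ h univ := fun φ _ => by
    refine AnalyticAt.re_ofReal (f := fun w => qAlpha α (ρ * exp (w * I))) ?_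
    refine (analyticOnNhd_qAlpha h0 h1 _ ?_).comp (by fun_prop)
    rw [mem_unitBall, CircleMonotone.norm_polar hρ0.le]
    exact hρ1
  obtain ⟨m, hm1, hm2⟩ := exists_between hst
  have hev : h =ᶠ[𝓝 m] fun _ => 1 := by
    filter_upwards [Ioo_mem_nhds hm1 hm2] with u hu
    have hu' : u ∈ Icc 0 Real.pi := ⟨hs.1.trans hu.1.le, hu.2.le.trans ht.2⟩
    exact le_antisymm (es ▸ ha hs hu' hu.1.le) (et ▸ ha hu' ht hu.2.le)
  have hall := han.eqOn_of_preconnected_of_eventuallyEq analyticOnNhd_const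
    isPreconnected_univ (mem_univ m) hev
  have h00 : h 0 = 1 := hall (mem_univ 0)
  have hq := qAlpha_strictMonoOn h0 h1 (a := 0) (b := ρ) (by norm_num) ⟨by linarith, hρ1⟩ hρ0
  simp [hh] at h00
  simp [qAlpha_zero, h00] at hq

lemma qAlpha_im_le_of_re_eq_one {α : ℝ} (h0 : 0 ≤ α) (h1 : α < 1) {c e : ℂ} (hc : ‖c‖ < 1)
    (hc0 : c ≠ 0) (hci : 0 ≤ c.im) (hcq : (qAlpha α c).re = 1) (he : ‖e‖ = ‖c‖)
    (heq : (qAlpha α e).re = 1) : (qAlpha α e).im ≤ (qAlpha α c).im := by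
  have key : ∀ e : ℂ, ‖e‖ = ‖c‖ → (qAlpha α e).re = 1 → 0 ≤ e.im → e = c := by
    intro e he heq hei
    have := eq_of_qAlpha_re_eq_one h0 h1 (norm_pos_iff.2 hc0) hc (arg_mem_Icc_of_im_nonneg hei)
      (arg_mem_Icc_of_im_nonneg hci) (by rw [← he, norm_mul_exp_arg_mul_I, heq])
      (by rw [norm_mul_exp_arg_mul_I, hcq])
    rw [← norm_mul_exp_arg_mul_I e, he, this, norm_mul_exp_arg_mul_I]
  rcases le_or_gt 0 e.im with hi | hi
  · rw [key e he heq hi]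
  · have he1 : ‖e‖ < 1 := he ▸ hc
    have h2 := key (conj e) (by rwa [norm_conj]) (by rwa [qAlpha_conj h0 h1 he1, conj_re])
      (by simpa using hi.le)
    have h3 : (qAlpha α c).im = -(qAlpha α e).im := by
      rw [← h2, qAlpha_conj h0 h1 he1, conj_im]
    have := (circleMonotone_qAlpha h0 h1).im_nonneg c hc hci
    linarith

/-- Maximise `Im q_α` over the points of the closed disk with `Re q_α = 1`. The maximum is on the
boundary because `q_α` is open, and a boundary point of this kind is `c` or its conjugate. -/
lemma qAlpha_im_lt_of_re_eq_one {α : ℝ} (h0 : 0 ≤ α) (h1 : α < 1) {c ζ : ℂ} (hc : ‖c‖ < 1)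
    (hci : 0 ≤ c.im) (hcq : (qAlpha α c).re = 1) (hζ : ‖ζ‖ < ‖c‖) (hζq : (qAlpha α ζ).re = 1) :
    (qAlpha α ζ).im < (qAlpha α c).im := by
  have hc0 : c ≠ 0 := norm_pos_iff.1 ((norm_nonneg ζ).trans_lt hζ)
  have hsub : Metric.closedBall (0 : ℂ) ‖c‖ ⊆ Metric.ball 0 1 := Metric.closedBall_subset_ball hc
  have hcont : ContinuousOn (qAlpha α) (Metric.closedBall 0 ‖c‖) :=
    (differentiableOn_qAlpha h0 h1).continuousOn.mono hsub
  set S := Metric.closedBall (0 : ℂ) ‖c‖ ∩ qAlpha α ⁻¹' {w | w.re = 1}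
  have hS : IsCompact S := by
    refine (isCompact_closedBall _ _).of_isClosed_subset
      (hcont.preimage_isClosed_of_isClosed Metric.isClosed_closedBall
        (isClosed_eq continuous_re continuous_const)) inter_subset_left
  have interior : ∀ e, ‖e‖ < ‖c‖ → (qAlpha α e).re = 1 →
      ∃ e' ∈ S, (qAlpha α e).im < (qAlpha α e').im := by
    intro e he heq
    have hb : Metric.ball (0 : ℂ) ‖c‖ ⊆ Metric.ball 0 1 := Metric.ball_subset_ball hc.le
    rcases (analyticOnNhd_qAlpha h0 h1).is_constant_or_isOpen (isPreconnected_ball_zero 1) with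
      ⟨w, hw⟩ | hop
    · exfalso
      have : w = 1 := by rw [← hw 0 (by simp), qAlpha_zero]
      exact exists_qAlpha_ne_one h0 h1 fun z hz => by rw [hw z hz, this]; rfl
    · have ho := hop _ hb Metric.isOpen_ball
      have hmem : qAlpha α e ∈ qAlpha α '' Metric.ball 0 ‖c‖ := ⟨e, by simpa using he, rfl⟩
      -- Moving the value straight up keeps its real part equal to `1`; openness keeps it in the
      -- image.
      have ht : Tendsto (fun t : ℝ => qAlpha α e + t * I) (𝓝[>] 0) (𝓝 (qAlpha α e)) := by
        have : Continuous (fun t : ℝ => qAlpha α e + t * I) := by fun_prop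
        simpa using (this.tendsto 0).mono_left nhdsWithin_le_nhds
      obtain ⟨t, ⟨e', he', hte⟩, hpos⟩ :=
        ((ht.eventually (ho.mem_nhds hmem)).and self_mem_nhdsWithin).exists
      refine ⟨e', ⟨Metric.ball_subset_closedBall he', ?_⟩, ?_⟩
      · simp [hte, heq]
      · rw [hte]
        simpa using hpos
  obtain ⟨e, heS, hmax⟩ := hS.exists_isMaxOn ⟨ζ, by simpa using hζ.le, hζq⟩
    (continuous_im.comp_continuousOn (hcont.mono inter_subset_left))
  have hen : ‖e‖ ≤ ‖c‖ := by simpa using heS.1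
  have heq : (qAlpha α e).re = 1 := heS.2
  have henc : ‖e‖ = ‖c‖ := by
    refine hen.eq_of_not_lt fun hlt => ?_
    obtain ⟨e', he', hlt'⟩ := interior e hlt heq
    exact absurd (hmax he') (not_le.2 hlt')
  obtain ⟨e', he', hlt⟩ := interior ζ hζ hζq
  exact (hlt.trans_le (hmax he')).trans_le
    (qAlpha_im_le_of_re_eq_one h0 h1 hc hc0 hci hcq henc heq)

lemma abs_qAlpha_im_lt_of_re_eq_one {α : ℝ} (h0 : 0 ≤ α) (h1 : α < 1) {c ζ : ℂ} (hc : ‖c‖ < 1)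
    (hci : 0 ≤ c.im) (hcq : (qAlpha α c).re = 1) (hζ : ‖ζ‖ < ‖c‖) (hζq : (qAlpha α ζ).re = 1) :
    |(qAlpha α ζ).im| < (qAlpha α c).im := by
  have hζ1 := hζ.trans hc
  refine abs_lt.2 ⟨?_, qAlpha_im_lt_of_re_eq_one h0 h1 hc hci hcq hζ hζq⟩
  have := qAlpha_im_lt_of_re_eq_one h0 h1 hc hci hcq (ζ := conj ζ) (by rwa [norm_conj])
    (by rwa [qAlpha_conj h0 h1 hζ1, conj_re])
  rw [qAlpha_conj h0 h1 hζ1, conj_im] at this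
  linarith

/-! ### Logarithmic primitives and their comparison along rays. -/

/-- `p` is the analytic function on the unit disk with `p 0 = 0` and `z p'(z) = g(z) - 1`. -/
structure IsLogPrimitive (p g : ℂ → ℂ) : Prop where
  differentiableOn : DifferentiableOn ℂ p (Metric.ball 0 1)
  map_zero : p 0 = 0
  mul_deriv : ∀ z : ℂ, ‖z‖ < 1 → z * deriv p z = g z - 1

namespace IsLogPrimitive

variable {p g p₁ g₁ p₂ g₂ : ℂ → ℂ}

lemma differentiableAt (h : IsLogPrimitive p g) {z : ℂ} (hz : ‖z‖ < 1) : DifferentiableAt ℂ p z :=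
  h.differentiableOn.differentiableAt (Metric.isOpen_ball.mem_nhds (mem_unitBall.2 hz))

lemma hasDerivAt_ray (h : IsLogPrimitive p g) {z : ℂ} (hz : ‖z‖ < 1) {t : ℝ}
    (ht0 : 0 < t) (ht1 : t ≤ 1) :
    HasDerivAt (fun t : ℝ => p (t * z)) ((g (t * z) - 1) / t) t := by
  have hz' := norm_ofReal_mul_lt ht0.le ht1 hz
  have ht : (t : ℂ) ≠ 0 := by exact_mod_cast ht0.ne'
  have h2 : HasDerivAt (fun t : ℝ => (t : ℂ) * z) z t := by
    simpa using (hasDerivAt_id t).ofReal_comp.mul_const z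
  refine ((h.differentiableAt hz').hasDerivAt.comp t h2).congr_deriv ?_
  rw [← h.mul_deriv _ hz']
  field_simp

lemma continuousOn_ray (h : IsLogPrimitive p g) {z : ℂ} (hz : ‖z‖ < 1) :
    ContinuousOn (fun t : ℝ => p (t * z)) (Icc 0 1) := by
  refine h.differentiableOn.continuousOn.comp (by fun_prop) fun t ht => ?_
  exact mem_unitBall.2 (norm_ofReal_mul_lt ht.1 ht.2 hz)

lemma hasDerivAt_sub_ray (h₁ : IsLogPrimitive p₁ g₁) (h₂ : IsLogPrimitive p₂ g₂) (L : ℂ →L[ℝ] ℝ)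
    {z₁ z₂ : ℂ} (hz₁ : ‖z₁‖ < 1) (hz₂ : ‖z₂‖ < 1) {t : ℝ} (ht0 : 0 < t) (ht1 : t ≤ 1) :
    HasDerivAt (fun t : ℝ => L (p₂ (t * z₂)) - L (p₁ (t * z₁)))
      ((L (g₂ (t * z₂)) - L (g₁ (t * z₁))) / t) t := by
  have e := ((L.hasFDerivAt.comp_hasDerivAt t (h₂.hasDerivAt_ray hz₂ ht0 ht1)).sub
    (L.hasFDerivAt.comp_hasDerivAt t (h₁.hasDerivAt_ray hz₁ ht0 ht1)))
  refine e.congr_deriv ?_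
  have hdiv : ∀ w : ℂ, L (w / t) = L w / t := fun w => by
    rw [div_eq_inv_mul, ← ofReal_inv, ← real_smul, map_smul, smul_eq_mul, div_eq_inv_mul]
  rw [hdiv, hdiv, map_sub, map_sub]
  ring

lemma continuousOn_sub_ray (h₁ : IsLogPrimitive p₁ g₁) (h₂ : IsLogPrimitive p₂ g₂)
    (L : ℂ →L[ℝ] ℝ) {z₁ z₂ : ℂ} (hz₁ : ‖z₁‖ < 1) (hz₂ : ‖z₂‖ < 1) :
    ContinuousOn (fun t : ℝ => L (p₂ (t * z₂)) - L (p₁ (t * z₁))) (Icc 0 1) :=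
  (L.continuous.comp_continuousOn (h₂.continuousOn_ray hz₂)).sub
    (L.continuous.comp_continuousOn (h₁.continuousOn_ray hz₁))

/-- Both primitives vanish at `0`, and the derivative of the difference along the rays is the
hypothesis divided by `t`. The functional `L` serves both real and imaginary parts. -/
lemma apply_le_apply (h₁ : IsLogPrimitive p₁ g₁) (h₂ : IsLogPrimitive p₂ g₂) (L : ℂ →L[ℝ] ℝ)
    {z₁ z₂ : ℂ} (hz₁ : ‖z₁‖ < 1) (hz₂ : ‖z₂‖ < 1)
    (h : ∀ t : ℝ, 0 < t → t < 1 → L (g₁ (t * z₁)) ≤ L (g₂ (t * z₂))) :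
    L (p₁ z₁) ≤ L (p₂ z₂) := by
  have hm : MonotoneOn (fun t : ℝ => L (p₂ (t * z₂)) - L (p₁ (t * z₁))) (Icc 0 1) := by
    refine monotoneOn_of_deriv_nonneg (convex_Icc 0 1)
      (continuousOn_sub_ray h₁ h₂ L hz₁ hz₂) ?_ ?_ <;> rw [interior_Icc]
    · exact fun t ht => (hasDerivAt_sub_ray h₁ h₂ L hz₁ hz₂ ht.1
        ht.2.le).differentiableAt.differentiableWithinAt
    · intro t ht
      rw [(hasDerivAt_sub_ray h₁ h₂ L hz₁ hz₂ ht.1 ht.2.le).deriv]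
      exact div_nonneg (sub_nonneg.2 (h t ht.1 ht.2)) ht.1.le
  have := hm (left_mem_Icc.2 zero_le_one) (right_mem_Icc.2 zero_le_one) zero_le_one
  simpa [h₁.map_zero, h₂.map_zero] using this

lemma apply_lt_apply (h₁ : IsLogPrimitive p₁ g₁) (h₂ : IsLogPrimitive p₂ g₂) (L : ℂ →L[ℝ] ℝ)
    {z₁ z₂ : ℂ} (hz₁ : ‖z₁‖ < 1) (hz₂ : ‖z₂‖ < 1)
    (h : ∀ t : ℝ, 0 < t → t < 1 → L (g₁ (t * z₁)) < L (g₂ (t * z₂))) :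
    L (p₁ z₁) < L (p₂ z₂) := by
  have hm : StrictMonoOn (fun t : ℝ => L (p₂ (t * z₂)) - L (p₁ (t * z₁))) (Icc 0 1) := by
    refine strictMonoOn_of_deriv_pos (convex_Icc 0 1)
      (continuousOn_sub_ray h₁ h₂ L hz₁ hz₂) ?_
    rw [interior_Icc]
    intro t ht
    rw [(hasDerivAt_sub_ray h₁ h₂ L hz₁ hz₂ ht.1 ht.2.le).deriv]
    exact div_pos (sub_pos.2 (h t ht.1 ht.2)) ht.1
  have := hm (left_mem_Icc.2 zero_le_one) (right_mem_Icc.2 zero_le_one) one_pos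
  simpa [h₁.map_zero, h₂.map_zero] using this

lemma apply_eq_apply (h₁ : IsLogPrimitive p₁ g₁) (h₂ : IsLogPrimitive p₂ g₂)
    {z₁ z₂ : ℂ} (hz₁ : ‖z₁‖ < 1) (hz₂ : ‖z₂‖ < 1)
    (h : ∀ t : ℝ, 0 < t → t < 1 → g₁ (t * z₁) = g₂ (t * z₂)) : p₁ z₁ = p₂ z₂ := by
  have key : ∀ L : ℂ →L[ℝ] ℝ, L (p₁ z₁) = L (p₂ z₂) := fun L => le_antisymm
    (apply_le_apply h₁ h₂ L hz₁ hz₂ fun t h0 h1 => (congrArg L (h t h0 h1)).le)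
    (apply_le_apply h₂ h₁ L hz₂ hz₁ fun t h0 h1 => (congrArg L (h t h0 h1)).ge)
  exact Complex.ext (key reCLM) (key imCLM)

/-- The derivative of `Im p` along the circle is `Re (z p') = Re g - 1`. -/
lemma re_eq_one_of_isMax (h : IsLogPrimitive p g) {z : ℂ} (hz : ‖z‖ < 1) {s : ℝ} (hs : s ≠ 0)
    (hmax : ∀ z', ‖z'‖ = ‖z‖ → s * (p z').im ≤ s * (p z).im) : (g z).re = 1 := by
  have h1 : HasDerivAt (fun φ : ℝ => z * exp (φ * I)) (z * I) 0 := by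
    have h2 : HasDerivAt (fun φ : ℝ => (φ : ℂ) * I) I 0 := by
      simpa using (hasDerivAt_id (0 : ℝ)).ofReal_comp.mul_const I
    refine (h2.cexp.const_mul z).congr_deriv (by simp)
  have h3 : HasDerivAt p (deriv p z) (z * exp (((0 : ℝ) : ℂ) * I)) := by
    simpa using (h.differentiableAt hz).hasDerivAt
  have h4 := (imCLM.hasFDerivAt.comp_hasDerivAt (0 : ℝ) (h3.comp (0 : ℝ) h1)).const_mul s
  have h5 : IsLocalMax (fun φ : ℝ => s * (p (z * exp (φ * I))).im) 0 := by
    refine Eventually.of_forall fun φ => ?_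
    simp only [ofReal_zero, zero_mul, exp_zero, mul_one]
    exact hmax _ (by rw [norm_mul, norm_exp_ofReal_mul_I, mul_one])
  have h6 := h5.hasDerivAt_eq_zero h4
  rw [show deriv p z * (z * I) = (g z - 1) * I by rw [← h.mul_deriv z hz]; ring] at h6
  simp only [imCLM_apply, mul_eq_zero, hs, false_or] at h6
  simp at h6
  linarith

end IsLogPrimitive

/-- The logarithm of `f_α(z) / z`. -/
noncomputable def logFAlpha (α : ℝ) (z : ℂ) : ℂ := log (overId (fAlpha α) z)

lemma exp_logFAlpha {α : ℝ} (h0 : 0 ≤ α) (h1 : α < 1) {z : ℂ} (hz : ‖z‖ < 1) :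
    exp (logFAlpha α z) = overId (fAlpha α) z :=
  exp_log (slitPlane_ne_zero (overId_fAlpha_mem_slitPlane h0 h1 hz))

lemma isLogPrimitive_logFAlpha {α : ℝ} (h0 : 0 ≤ α) (h1 : α < 1) :
    IsLogPrimitive (logFAlpha α) (qAlpha α) := by
  have hF := differentiableOn_overId (fAlpha_zero α) (differentiableOn_fAlpha α)
  refine ⟨hF.clog fun z hz => overId_fAlpha_mem_slitPlane h0 h1 (mem_unitBall.1 hz), ?_, ?_⟩
  · simp [logFAlpha, overId, deriv_fAlpha α (z := 0) (by simp)]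
  · intro z hz
    have hs := overId_fAlpha_mem_slitPlane h0 h1 hz
    have hd := (hF.differentiableAt
      (Metric.isOpen_ball.mem_nhds (mem_unitBall.2 hz))).hasDerivAt.clog hs
    have e : deriv (logFAlpha α) z = deriv (overId (fAlpha α)) z / overId (fAlpha α) z := hd.deriv
    rw [e, qAlpha_eq_div h0 h1 hz, ← mul_div_assoc,
      mul_deriv_overId (fAlpha_zero α) (differentiableOn_fAlpha α) hz, sub_div,
      div_self (slitPlane_ne_zero hs)]

/-! ### The rotation estimate by circular maxima. -/

/-- On each disk a continuous function has circular maxima that depend continuously on the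
radius. -/
lemma exists_continuous_circleMax {u : ℂ → ℝ} {r : ℝ} (hr : 0 ≤ r)
    (hu : ContinuousOn u (Metric.closedBall 0 r)) :
    ∃ M : ℝ → ℝ, Continuous M ∧ (∀ c, ‖c‖ ≤ r → u c ≤ M ‖c‖) ∧
      ∀ ρ, 0 ≤ ρ → ρ ≤ r → ∃ c, ‖c‖ = ρ ∧ u c = M ρ := by
  -- Clamping the radius to `[0, r]` makes `F` continuous on all of `ℝ × ℝ`.
  set F : ℝ → ℝ → ℝ := fun ρ φ => u ((max 0 (min ρ r) : ℝ) * exp (φ * I)) with hF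
  have hFc : Continuous ↿F := by
    refine hu.comp_continuous (f := fun x : ℝ × ℝ => ((max 0 (min x.1 r) : ℝ) : ℂ) *
      exp ((x.2 : ℝ) * I)) (by fun_prop) fun x => ?_
    rw [Metric.mem_closedBall, dist_zero_right, CircleMonotone.norm_polar (le_max_left _ _)]
    exact max_le hr (min_le_right _ _)
  have hK : IsCompact (Icc (-Real.pi) Real.pi) := isCompact_Icc
  have hFρ : ∀ ρ, Continuous (F ρ) := fun ρ => hFc.comp (by fun_prop : Continuous fun φ => (ρ, φ))
  have hne : (Icc (-Real.pi) Real.pi).Nonempty := ⟨0, by simp [Real.pi_pos.le]⟩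
  have hcl : ∀ ρ, 0 ≤ ρ → ρ ≤ r → max 0 (min ρ r) = ρ := fun ρ h0 h1 => by
    rw [min_eq_left h1, max_eq_right h0]
  refine ⟨fun ρ => sSup (F ρ '' Icc (-Real.pi) Real.pi), hK.continuous_sSup hFc, ?_, ?_⟩
  · intro c hc
    have e : u c = F ‖c‖ (arg c) := by
      simp only [hF]
      rw [hcl _ (norm_nonneg c) hc, norm_mul_exp_arg_mul_I]
    rw [e]
    exact le_csSup (hK.image (hFρ _)).bddAbove
      ⟨arg c, ⟨(neg_pi_lt_arg c).le, arg_le_pi c⟩, rfl⟩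
  · intro ρ h0 h1
    obtain ⟨φ, -, hφ⟩ := hK.exists_sSup_image_eq hne (hFρ ρ).continuousOn
    refine ⟨ρ * exp (φ * I), CircleMonotone.norm_polar h0 φ, ?_⟩
    change u _ = sSup (F ρ '' Icc (-Real.pi) Real.pi)
    rw [hφ]
    simp only [hF, hcl ρ h0 h1]

lemma logFAlpha_im_neg {α : ℝ} (h0 : 0 ≤ α) (h1 : α < 1) {z : ℂ} (hz : ‖z‖ < 1)
    (hi : z.im < 0) : (logFAlpha α z).im < 0 := by
  rw [logFAlpha, log_im]
  exact arg_neg_iff.2 (overId_fAlpha_im_neg h0 h1 hz hi)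

lemma logFAlpha_im_ofReal {α : ℝ} {t : ℝ} (ht : |t| < 1) : (logFAlpha α t).im = 0 := by
  obtain ⟨hre, him⟩ := overId_fAlpha_ofReal α ht
  rw [logFAlpha, log_im]
  exact arg_eq_zero_iff.2 ⟨hre.le, him⟩

section rotation

variable {α : ℝ} {p w : ℂ → ℂ}

/-- At a maximum of `s Im p(z) - M(|z|)`, where `M` is the circular maximum of `Im log(f_α(z)/z)`,
some extremal point `c` on the same circle satisfies `Im q_α(c) ≤ s Im q_α(w(z))`. -/
lemma exists_qAlpha_im_le_of_isMax (h0 : 0 ≤ α) (h1 : α < 1)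
    (hp : IsLogPrimitive p fun z => qAlpha α (w z)) (hw : IsSchwarzFunction w) {s : ℝ}
    {M : ℝ → ℝ} (hM : Continuous M) {z : ℂ} (hz : ‖z‖ < 1) (hz0 : z ≠ 0)
    (hMle : ∀ c : ℂ, ‖c‖ = ‖z‖ → (logFAlpha α c).im ≤ M ‖z‖)
    (hMex : ∀ ρ, 0 ≤ ρ → ρ ≤ ‖z‖ → ∃ c, ‖c‖ = ρ ∧ (logFAlpha α c).im = M ρ)
    (hmax : ∀ z', ‖z'‖ ≤ ‖z‖ → s * (p z').im - M ‖z'‖ ≤ s * (p z).im - M ‖z‖) :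
    ∃ c : ℂ, ‖c‖ = ‖z‖ ∧ (logFAlpha α c).im = M ‖z‖ ∧
      (qAlpha α c).im ≤ s * (qAlpha α (w z)).im := by
  have hP := isLogPrimitive_logFAlpha h0 h1
  have key : ∀ t : ℝ, 0 < t → t < 1 → ∃ e : ℂ, ∃ u : ℝ, ‖e‖ = ‖z‖ ∧
      (logFAlpha α (t * e)).im = M (t * ‖z‖) ∧ t < u ∧ u < 1 ∧
      (qAlpha α (u * e)).im ≤ s * (qAlpha α (w (u * z))).im := by
    intro t ht0 ht1
    have htz : t * ‖z‖ ≤ ‖z‖ := by nlinarith [norm_nonneg z]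
    obtain ⟨c, hc, hcM⟩ := hMex (t * ‖z‖) (by positivity) htz
    have ht : (t : ℂ) ≠ 0 := by exact_mod_cast ht0.ne'
    -- `M` need not be differentiable, so its growth from `t|z|` to `|z|` is bounded below by
    -- following the ray of a maximiser at radius `t|z|` outwards.
    set e := c / t with he
    have hte : (t : ℂ) * e = c := by rw [he]; field_simp
    have hen : ‖e‖ = ‖z‖ := by
      rw [he, norm_div, hc, norm_real, Real.norm_of_nonneg ht0.le]; field_simp
    have he1 : ‖e‖ < 1 := hen ▸ hz
    set G : ℝ → ℝ := fun u => (logFAlpha α (u * e)).im - s * (p (u * z)).im with hG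
    have hGd : ∀ u ∈ Ioo t 1, HasDerivAt G
        (((qAlpha α (u * e)).im - s * (qAlpha α (w (u * z))).im) / u) u := by
      intro u hu
      have hu0 := ht0.trans hu.1
      have d1 := imCLM.hasFDerivAt.comp_hasDerivAt u (hP.hasDerivAt_ray he1 hu0 hu.2.le)
      have d2 := (imCLM.hasFDerivAt.comp_hasDerivAt u (hp.hasDerivAt_ray hz hu0 hu.2.le)).const_mul s
      refine (d1.sub d2).congr_deriv ?_
      simp only [imCLM_apply, div_ofReal_im, sub_im, one_im, sub_zero]
      ring
    have hGc : ContinuousOn G (Icc t 1) := by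
      refine ContinuousOn.mono ?_ (Icc_subset_Icc_left ht0.le : Icc t 1 ⊆ Icc 0 1)
      exact (continuous_im.comp_continuousOn (hP.continuousOn_ray he1)).sub
        (continuousOn_const.mul (continuous_im.comp_continuousOn (hp.continuousOn_ray hz)))
    obtain ⟨u, hu, hus⟩ := exists_hasDerivAt_eq_slope G _ ht1 hGc hGd
    have hu0 := ht0.trans hu.1
    -- `G t` is minus the maximised quantity at `t z`, and `G 1` is at most minus its value at `z`;
    -- so `G 1 ≤ G t`, and the mean value point `u` has a non-positive derivative.
    refine ⟨e, u, hen, by rw [hte, hcM], hu.1, hu.2, ?_⟩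
    have a1 := hMle e hen
    have a2 := hmax (t * z) (by rwa [norm_mul, norm_real, Real.norm_of_nonneg ht0.le])
    rw [norm_mul, norm_real, Real.norm_of_nonneg ht0.le, ← hcM, ← hte] at a2
    have a3 : G 1 - G t ≤ 0 := by
      simp only [hG, ofReal_one, one_mul]
      linarith
    have a4 : (G 1 - G t) / (1 - t) ≤ 0 :=
      div_nonpos_of_nonpos_of_nonneg a3 (by linarith)
    rw [← hus, div_le_iff₀ hu0, zero_mul] at a4
    linarith
  -- The shift by `2` keeps every term strictly between `0` and `1`; a convergent subsequence of the
  -- directions `e n` then yields `c`.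
  set t : ℕ → ℝ := fun n => 1 - 1 / ((n : ℝ) + 2) with ht
  have htlim : Tendsto t atTop (𝓝 1) := by
    have : Tendsto (fun n : ℕ => 1 / ((n : ℝ) + 2)) atTop (𝓝 0) := by
      have := (tendsto_one_div_add_atTop_nhds_zero_nat (𝕜 := ℝ)).comp (tendsto_add_atTop_nat 1)
      refine this.congr fun n => ?_
      simp only [Function.comp]; push_cast; ring
    simpa [ht] using this.const_sub 1
  have htpos : ∀ n, 0 < t n ∧ t n < 1 := fun n => by
    have h2 : (0 : ℝ) < (n : ℝ) + 2 := by positivity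
    have h3 : 1 / ((n : ℝ) + 2) < 1 := by
      rw [div_lt_one h2]; linarith [n.cast_nonneg (α := ℝ)]
    simp only [ht]
    constructor
    · linarith
    · have : 0 < 1 / ((n : ℝ) + 2) := by positivity
      linarith
  choose e u he hM' htu hu1 hle using fun n => key (t n) (htpos n).1 (htpos n).2
  have hulim : Tendsto u atTop (𝓝 1) :=
    tendsto_of_tendsto_of_tendsto_of_le_of_le htlim tendsto_const_nhds
      (fun n => (htu n).le) fun n => (hu1 n).le
  obtain ⟨c, hc, ψ, hψ, hlim⟩ := (isCompact_sphere (0 : ℂ) ‖z‖).tendsto_subseq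
    (x := e) fun n => by simpa using he n
  have hcn : ‖c‖ = ‖z‖ := by simpa using hc
  have hc1 : ‖c‖ < 1 := hcn ▸ hz
  have hcont : ∀ {v : ℂ → ℂ}, DifferentiableOn ℂ v (Metric.ball 0 1) → ∀ x : ℂ, ‖x‖ < 1 →
      ContinuousAt v x := fun hv x hx =>
    (hv.differentiableAt (Metric.isOpen_ball.mem_nhds (mem_unitBall.2 hx))).continuousAt
  have hmul : ∀ {a : ℕ → ℝ} {b : ℕ → ℂ} {x : ℂ}, Tendsto a atTop (𝓝 1) → Tendsto b atTop (𝓝 x) →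
      Tendsto (fun n => (a n : ℂ) * b n) atTop (𝓝 x) := fun ha hb => by
    simpa using ((continuous_ofReal.tendsto 1).comp ha).mul hb
  have hψt := hψ.tendsto_atTop
  refine ⟨c, hcn, ?_, ?_⟩
  · have l1 := (continuous_im.tendsto _).comp ((hcont hP.differentiableOn c hc1).tendsto.comp
      (hmul (htlim.comp hψt) hlim))
    have l2 : Tendsto (fun n => M (t (ψ n) * ‖z‖)) atTop (𝓝 (M ‖z‖)) := by
      have := (htlim.comp hψt).mul_const ‖z‖
      rw [one_mul] at this
      exact (hM.tendsto _).comp this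
    exact tendsto_nhds_unique (l1.congr fun n => hM' (ψ n)) l2
  · have hwz : ‖w z‖ < 1 := mem_unitBall.1 (hw.2.2 (mem_unitBall.2 hz))
    have hq := differentiableOn_qAlpha h0 h1
    have l1 := (continuous_im.tendsto _).comp ((hcont hq c hc1).tendsto.comp
      (hmul (hulim.comp hψt) hlim))
    have l2 := (((continuous_im.tendsto _).comp ((hcont hq (w z) hwz).tendsto.comp
      ((hw.1 z (mem_unitBall.2 hz)).continuousAt.tendsto.comp
        (hmul (hulim.comp hψt) (tendsto_const_nhds (x := z)))))).const_mul s)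
    exact le_of_tendsto_of_tendsto' l1 l2 fun n => hle (ψ n)

/-- The strict rotation bound when the Schwarz function is not a rotation. -/
lemma exists_mul_im_lt_logFAlpha_im (h0 : 0 ≤ α) (h1 : α < 1)
    (hp : IsLogPrimitive p fun z => qAlpha α (w z)) (hw : IsSchwarzFunction w)
    (hlt : ∀ z, z ≠ 0 → ‖z‖ < 1 → ‖w z‖ < ‖z‖) {s : ℝ} (hs : |s| = 1)
    {z : ℂ} (hz : ‖z‖ < 1) (hz0 : z ≠ 0) :
    ∃ c, ‖c‖ = ‖z‖ ∧ s * (p z).im < (logFAlpha α c).im := by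
  have hP := isLogPrimitive_logFAlpha h0 h1
  have hsub : Metric.closedBall (0 : ℂ) ‖z‖ ⊆ Metric.ball 0 1 := Metric.closedBall_subset_ball hz
  obtain ⟨M, hM, hMle, hMex⟩ := exists_continuous_circleMax (norm_nonneg z)
    (continuous_im.comp_continuousOn (hP.differentiableOn.continuousOn.mono hsub))
  simp only [Function.comp] at hMle hMex
  have hs0 : s ≠ 0 := by rintro rfl; simp at hs
  set Φ : ℂ → ℝ := fun z => s * (p z).im - M ‖z‖ with hΦ
  have hM0 : M 0 = 0 := by
    obtain ⟨c, hc, hc'⟩ := hMex 0 le_rfl (norm_nonneg z)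
    rw [← hc', norm_eq_zero.1 hc, hP.map_zero]; rfl
  have hΦ0 : Φ 0 = 0 := by simp [hΦ, hp.map_zero, hM0]
  have claim : ∀ z', ‖z'‖ ≤ ‖z‖ → (∀ y, ‖y‖ ≤ ‖z‖ → Φ y ≤ Φ z') → z' = 0 := by
    intro z' hz' hmax
    by_contra hne
    have hz1 := hz'.trans_lt hz
    obtain ⟨c, hcn, hcM, hcq⟩ := exists_qAlpha_im_le_of_isMax h0 h1 hp hw hM hz1 hne
      (fun c hc => hc ▸ hMle c (hc.trans_le hz')) (fun ρ ha hb => hMex ρ ha (hb.trans hz'))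
      (fun y hy => hmax y (hy.trans hz'))
    have hc1 : ‖c‖ < 1 := hcn ▸ hz1
    have hre : (qAlpha α (w z')).re = 1 := hp.re_eq_one_of_isMax hz1 hs0 fun y hy => by
      have := hmax y (hy.trans_le hz')
      simp only [hΦ, hy] at this
      linarith
    have hcre : (qAlpha α c).re = 1 := hP.re_eq_one_of_isMax hc1 one_ne_zero fun y hy => by
      have h2 : ‖y‖ = ‖z'‖ := hy.trans hcn
      have := hMle y (h2.trans_le hz')
      rw [h2, ← hcM] at this
      linarith
    -- The maximum on a circle is at least the value `0` at its positive real point, whereas `Im log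
    -- (f_α(z)/z) < 0` in the lower half-disk.
    have hci : 0 ≤ c.im := by
      by_contra hneg
      have h3 := logFAlpha_im_neg h0 h1 hc1 (not_le.1 hneg)
      have h4 := hMle ((‖z'‖ : ℝ) : ℂ) (by simpa using hz')
      rw [logFAlpha_im_ofReal (by simpa using hz1), norm_real, norm_norm, ← hcM] at h4
      linarith
    have h5 := abs_qAlpha_im_lt_of_re_eq_one h0 h1 hc1 hci hcre (hcn ▸ hlt z' hne hz1) hre
    have h6 : s * (qAlpha α (w z')).im ≤ |(qAlpha α (w z')).im| := by
      refine (le_abs_self _).trans_eq ?_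
      rw [abs_mul, hs, one_mul]
    linarith
  have hΦc : ContinuousOn Φ (Metric.closedBall 0 ‖z‖) :=
    (continuousOn_const.mul (continuous_im.comp_continuousOn
      (hp.differentiableOn.continuousOn.mono hsub))).sub
      (hM.comp continuous_norm).continuousOn
  obtain ⟨z', hz', hmax⟩ := (isCompact_closedBall (0 : ℂ) ‖z‖).exists_isMaxOn
    ⟨0, by simp⟩ hΦc
  have hmax' : ∀ y, ‖y‖ ≤ ‖z‖ → Φ y ≤ Φ z' := fun y hy => hmax (by simpa using hy)
  have hz'0 := claim z' (by simpa using hz') hmax'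
  rw [hz'0, hΦ0] at hmax'
  -- Equality would make `z` itself a maximiser, which the claim excludes for `z ≠ 0`.
  have hneg : Φ z < 0 := by
    refine (hmax' z le_rfl).lt_of_ne fun h => hz0 (claim z le_rfl fun y hy => ?_)
    rw [h]
    exact hmax' y hy
  obtain ⟨c, hc, hcM⟩ := hMex ‖z‖ (norm_nonneg z) le_rfl
  refine ⟨c, hc, ?_⟩
  rw [hcM]
  simp only [hΦ] at hneg
  linarith

end rotation

/-! ### The Schwarz lemma and the logarithm of `f(z)/z`. -/

lemma IsSchwarzFunction.norm_le {w : ℂ → ℂ} (hw : IsSchwarzFunction w) {z : ℂ} (hz : ‖z‖ < 1) :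
    ‖w z‖ ≤ ‖z‖ :=
  norm_le_norm_of_mapsTo_ball hw.1.differentiableOn
    (hw.2.2.mono_right Metric.ball_subset_closedBall) hw.2.1 hz

lemma IsSchwarzFunction.exists_rotation {w : ℂ → ℂ} (hw : IsSchwarzFunction w) {z₀ : ℂ}
    (hz₀ : z₀ ≠ 0) (hz₁ : ‖z₀‖ < 1) (h : ‖w z₀‖ = ‖z₀‖) :
    ∃ θ : ℝ, ∀ z, ‖z‖ < 1 → w z = exp (θ * I) * z := by
  obtain ⟨C, hC, hCw⟩ := affine_of_mapsTo_ball_of_exists_norm_dslope_eq_div' (c := 0) (R₁ := 1)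
    (R₂ := 1) hw.1.differentiableOn
    (by rw [hw.2.1]; exact hw.2.2.mono_right Metric.ball_subset_closedBall)
    ⟨z₀, mem_unitBall.2 hz₁, by
      rw [dslope_of_ne _ hz₀, slope_def_field, hw.2.1, sub_zero, sub_zero, norm_div, h,
        div_self (norm_ne_zero_iff.2 hz₀), div_one]⟩
  refine ⟨arg C, fun z hz => ?_⟩
  have h1 := norm_mul_exp_arg_mul_I C
  rw [hC, div_one, ofReal_one, one_mul] at h1
  rw [hCw (mem_unitBall.2 hz), h1, hw.2.1]
  simp [mul_comm]

/-- Functions in `𝒮*(q_α)` have an analytic `log (f(z)/z)`. -/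
lemma StarlikeQ.exists_log {α : ℝ} {f : ℂ → ℂ} (hf : f ∈ StarlikeQ α) :
    ∃ w p : ℂ → ℂ, IsSchwarzFunction w ∧ IsLogPrimitive p (fun z => qAlpha α (w z)) ∧
      (∀ z, ‖z‖ < 1 → overId f z = exp (p z)) ∧
      ∀ z, ‖z‖ < 1 → deriv f z = qAlpha α (w z) * exp (p z) := by
  obtain ⟨⟨ha, hf0, hf1, hinj⟩, w, hw, hsub⟩ := hf
  have hd := ha.differentiableOn
  have hF := differentiableOn_overId hf0 hd
  have hFd : ∀ z ∈ Metric.ball (0 : ℂ) 1, HasDerivAt (overId f) (deriv (overId f) z) z :=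
    fun z hz => (hF.differentiableAt (Metric.isOpen_ball.mem_nhds hz)).hasDerivAt
  have hne : ∀ z ∈ Metric.ball (0 : ℂ) 1, overId f z ≠ 0 := by
    intro z hz
    by_cases h : z = 0
    · simp [overId, h, hf1]
    · simp only [overId, h, if_false]
      refine div_ne_zero (fun h0 => h (hinj hz (by simp) ?_)) h
      rw [h0, hf0]
  have hr : ∀ z, ‖z‖ < 1 → deriv f z = logDerivRatio f z * overId f z := by
    intro z hz
    by_cases h : z = 0
    · simp [logDerivRatio, overId, h]
    · have := hne z (mem_unitBall.2 hz)
      simp only [overId, h, if_false, logDerivRatio] at this ⊢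
      have hfz : f z ≠ 0 := fun h0 => this (by rw [h0, zero_div])
      field_simp
  -- `p` is the primitive of the logarithmic derivative of `f(z)/z`, which has no zeros because `f`
  -- is univalent.
  obtain ⟨p, hp0, hp⟩ := (((hF.deriv Metric.isOpen_ball).div hF hne).isExactOn_ball).with_val_at 0 0
  have hlog : ∀ z ∈ Metric.ball (0 : ℂ) 1, overId f z = exp (p z) := by
    have hq : ∀ z ∈ Metric.ball (0 : ℂ) 1,
        HasDerivAt (fun z => overId f z * exp (-p z)) 0 z := by
      intro z hz
      refine ((hFd z hz).mul (hp z hz).neg.cexp).congr_deriv ?_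
      have := hne z hz
      simp only [Pi.div_apply]
      field_simp
      ring
    intro z hz
    have hc := Metric.isOpen_ball.is_const_of_deriv_eq_zero (isPreconnected_ball_zero 1)
      (fun z hz => (hq z hz).differentiableAt.differentiableWithinAt)
      (fun z hz => (hq z hz).deriv) hz (Metric.mem_ball_self one_pos)
    have h1 : overId f 0 = 1 := by simp [overId, hf1]
    rw [hp0, neg_zero, exp_zero, h1, one_mul, exp_neg] at hc
    exact (mul_inv_eq_one₀ (exp_ne_zero _)).1 hc
  refine ⟨w, p, hw, ⟨fun z hz => (hp z hz).differentiableAt.differentiableWithinAt, hp0, ?_⟩,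
    fun z hz => hlog z (mem_unitBall.2 hz), fun z hz => ?_⟩
  · intro z hz
    have hz' := mem_unitBall.2 hz
    have := hne z hz'
    rw [(hp z hz').deriv, Pi.div_apply, ← mul_div_assoc, mul_deriv_overId hf0 hd hz, hr z hz,
      hsub z hz']
    field_simp
  · rw [hr z hz, hsub z (mem_unitBall.2 hz), hlog z (mem_unitBall.2 hz)]

/-! ### Bounds for `Re p` and for the argument. -/

section bounds

variable {α : ℝ} {p w : ℂ → ℂ}

lemma norm_map_ray_le (hw : IsSchwarzFunction w) {z : ℂ} (hz : ‖z‖ < 1) {t : ℝ} (h0 : 0 < t)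
    (h1 : t < 1) : ‖w (t * z)‖ ≤ t * ‖z‖ ∧ t * ‖z‖ < 1 := by
  have h2 := norm_ofReal_mul_lt h0.le h1.le hz
  have h3 := hw.norm_le h2
  rw [norm_mul, norm_real, Real.norm_of_nonneg h0.le] at h2 h3
  exact ⟨h3, h2⟩

lemma norm_map_ray_lt (hlt : ∀ z, z ≠ 0 → ‖z‖ < 1 → ‖w z‖ < ‖z‖) {z : ℂ} (hz : ‖z‖ < 1)
    (hz0 : z ≠ 0) {t : ℝ} (h0 : 0 < t) (h1 : t < 1) :
    ‖w (t * z)‖ < t * ‖z‖ ∧ t * ‖z‖ < 1 := by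
  have h2 := norm_ofReal_mul_lt h0.le h1.le hz
  have h3 := hlt (t * z) (mul_ne_zero (by exact_mod_cast h0.ne') hz0) h2
  rw [norm_mul, norm_real, Real.norm_of_nonneg h0.le] at h2 h3
  exact ⟨h3, h2⟩

lemma re_le_logFAlpha (h0 : 0 ≤ α) (h1 : α < 1)
    (hp : IsLogPrimitive p fun z => qAlpha α (w z)) (hw : IsSchwarzFunction w)
    {z : ℂ} (hz : ‖z‖ < 1) : (p z).re ≤ (logFAlpha α ‖z‖).re := by
  refine hp.apply_le_apply (isLogPrimitive_logFAlpha h0 h1) reCLM hz (by simpa using hz)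
    fun t ht0 ht1 => ?_
  obtain ⟨h2, h3⟩ := norm_map_ray_le hw hz ht0 ht1
  have := (re_le_norm _).trans (norm_qAlpha_le h0 h1 h2 h3)
  simpa using this

lemma logFAlpha_neg_le_re (h0 : 0 ≤ α) (h1 : α < 1)
    (hp : IsLogPrimitive p fun z => qAlpha α (w z)) (hw : IsSchwarzFunction w)
    {z : ℂ} (hz : ‖z‖ < 1) : (logFAlpha α ((-‖z‖ : ℝ) : ℂ)).re ≤ (p z).re := by
  refine (isLogPrimitive_logFAlpha h0 h1).apply_le_apply hp reCLM (by simpa using hz) hz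
    fun t ht0 ht1 => ?_
  obtain ⟨h2, h3⟩ := norm_map_ray_le hw hz ht0 ht1
  have := qAlpha_re_ge h0 h1 h2 h3
  simpa using this

lemma re_lt_logFAlpha (h0 : 0 ≤ α) (h1 : α < 1)
    (hp : IsLogPrimitive p fun z => qAlpha α (w z)) (hlt : ∀ z, z ≠ 0 → ‖z‖ < 1 → ‖w z‖ < ‖z‖)
    {z : ℂ} (hz : ‖z‖ < 1) (hz0 : z ≠ 0) : (p z).re < (logFAlpha α ‖z‖).re := by
  refine hp.apply_lt_apply (isLogPrimitive_logFAlpha h0 h1) reCLM hz (by simpa using hz)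
    fun t ht0 ht1 => ?_
  obtain ⟨h2, h3⟩ := norm_map_ray_lt hlt hz hz0 ht0 ht1
  have := (re_le_norm _).trans_lt (norm_qAlpha_lt h0 h1 h2 h3)
  simpa using this

lemma logFAlpha_neg_lt_re (h0 : 0 ≤ α) (h1 : α < 1)
    (hp : IsLogPrimitive p fun z => qAlpha α (w z)) (hlt : ∀ z, z ≠ 0 → ‖z‖ < 1 → ‖w z‖ < ‖z‖)
    {z : ℂ} (hz : ‖z‖ < 1) (hz0 : z ≠ 0) : (logFAlpha α ((-‖z‖ : ℝ) : ℂ)).re < (p z).re := by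
  refine (isLogPrimitive_logFAlpha h0 h1).apply_lt_apply hp reCLM (by simpa using hz) hz
    fun t ht0 ht1 => ?_
  obtain ⟨h2, h3⟩ := norm_map_ray_lt hlt hz hz0 ht0 ht1
  have := qAlpha_re_gt h0 h1 h2 h3
  simpa using this

/-- The rotation bound for `|arg|` when the Schwarz function is not a rotation. -/
lemma exists_abs_arg_lt (h0 : 0 ≤ α) (h1 : α < 1)
    (hp : IsLogPrimitive p fun z => qAlpha α (w z)) (hw : IsSchwarzFunction w)
    (hlt : ∀ z, z ≠ 0 → ‖z‖ < 1 → ‖w z‖ < ‖z‖) {z : ℂ} (hz : ‖z‖ < 1) (hz0 : z ≠ 0) :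
    ∃ c, ‖c‖ = ‖z‖ ∧ |(exp (p z)).arg| < (overId (fAlpha α) c).arg := by
  have key : ∃ c, ‖c‖ = ‖z‖ ∧ |(p z).im| < (logFAlpha α c).im := by
    rcases abs_cases (p z).im with ⟨h, -⟩ | ⟨h, -⟩
    · obtain ⟨c, hc, hlt'⟩ := exists_mul_im_lt_logFAlpha_im h0 h1 hp hw hlt (s := 1) (by simp) hz hz0
      exact ⟨c, hc, by rw [h]; linarith⟩
    · obtain ⟨c, hc, hlt'⟩ := exists_mul_im_lt_logFAlpha_im h0 h1 hp hw hlt (s := -1) (by simp) hz hz0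
      exact ⟨c, hc, by rw [h]; linarith⟩
  obtain ⟨c, hc, hlt'⟩ := key
  refine ⟨c, hc, ?_⟩
  rw [logFAlpha, log_im] at hlt'
  -- The bound is a principal argument, hence at most `π`; so `Im p` does not wrap around and is the
  -- principal argument of `exp p`.
  have h2 := abs_lt.1 (hlt'.trans_le (arg_le_pi _))
  rwa [← log_im (exp (p z)), log_exp h2.1 h2.2.le]

end bounds

/-! ### Values on the real axis in explicit form. -/

lemma overId_fAlpha_ofReal_eq {α : ℝ} {t : ℝ} (ht : |t| < 1) :
    overId (fAlpha α) t = (Real.exp (logFAlpha α t).re : ℂ) := by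
  obtain ⟨hre, him⟩ := overId_fAlpha_ofReal α ht
  have e : overId (fAlpha α) t = (((overId (fAlpha α) t).re : ℝ) : ℂ) := Complex.ext (by simp) (by simp [him])
  have hne : overId (fAlpha α) t ≠ 0 := by
    intro h; rw [h] at hre; simp at hre
  rw [logFAlpha, log_re, Real.exp_log (norm_pos_iff.2 hne)]
  rw [e, norm_real, Real.norm_of_nonneg hre.le]

lemma one_sub_ofReal_cpow {t : ℝ} (ht : t < 1) (c : ℝ) :
    (1 - (t : ℂ)) ^ (c : ℂ) = (((1 - t) ^ c : ℝ) : ℂ) := by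
  rw [ofReal_cpow (by linarith)]
  push_cast; rfl

lemma fAlpha_ofReal (α : ℝ) {r : ℝ} (hr : r < 1) : fAlpha α (r : ℂ) = (growthUpper α r : ℂ) := by
  unfold fAlpha growthUpper
  split_ifs with h
  · have : (1 - (r : ℂ)) = ((1 - r : ℝ) : ℂ) := by push_cast; rfl
    rw [this, ← ofReal_log (by linarith)]
    push_cast; rfl
  · have : (2 * (α : ℂ) - 1) = ((2 * α - 1 : ℝ) : ℂ) := by push_cast; rfl
    rw [this, one_sub_ofReal_cpow hr]
    push_cast; rfl

lemma growthUpper_neg (α r : ℝ) : growthUpper α (-r) = -growthLower α r := by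
  unfold growthUpper growthLower
  split_ifs <;> rw [sub_neg_eq_add]
  ring

lemma growthUpper_eq {α t : ℝ} (ht : |t| < 1) :
    growthUpper α t = t * Real.exp (logFAlpha α t).re := by
  have h := fAlpha_ofReal α (abs_lt.1 ht).2
  rw [← overId_mul (fAlpha_zero α), overId_fAlpha_ofReal_eq ht] at h
  have h2 : (Real.exp (logFAlpha α t).re) * t = growthUpper α t := by exact_mod_cast h
  rw [← h2, mul_comm]

lemma growthLower_eq {α t : ℝ} (ht : |t| < 1) :
    growthLower α t = t * Real.exp (logFAlpha α ((-t : ℝ) : ℂ)).re := by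
  have h := growthUpper_eq (α := α) (t := -t) (by rwa [abs_neg])
  rw [growthUpper_neg] at h
  linarith

lemma deriv_fAlpha_ofReal (α : ℝ) {t : ℝ} (ht : |t| < 1) :
    deriv (fAlpha α) (t : ℂ) = (((1 - t) ^ (2 * (α - 1)) : ℝ) : ℂ) := by
  rw [deriv_fAlpha α (by simpa using ht), one_sub_ofReal_cpow (abs_lt.1 ht).2]
  congr 2
  ring

lemma rpow_eq_qAlpha_mul {α : ℝ} (h0 : 0 ≤ α) (h1 : α < 1) {t : ℝ} (ht : |t| < 1) :
    (1 - t) ^ (2 * (α - 1)) = (qAlpha α t).re * Real.exp (logFAlpha α t).re := by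
  have hz : ‖(t : ℂ)‖ < 1 := by simpa using ht
  have h := deriv_fAlpha_ofReal α ht
  have e := qAlpha_eq_div h0 h1 hz
  rw [h, overId_fAlpha_ofReal_eq ht, ← ofReal_div] at e
  rw [e, ofReal_re]
  field_simp

/-! ### Rotations of the extremal function and the maximal argument. -/

lemma norm_exp_mul_I_mul (θ : ℝ) (z : ℂ) : ‖exp (θ * I) * z‖ = ‖z‖ := by
  rw [norm_mul, norm_exp_ofReal_mul_I, one_mul]

lemma exp_mul_I_mul_cancel (θ : ℝ) (z : ℂ) : exp (θ * I) * (exp (-(θ * I)) * z) = z := by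
  rw [← mul_assoc, ← exp_add, add_neg_cancel, exp_zero, one_mul]

lemma norm_exp_neg_mul_I_mul (θ : ℝ) (z : ℂ) : ‖exp (-(θ * I)) * z‖ = ‖z‖ := by
  rw [← norm_exp_mul_I_mul θ (exp (-(θ * I)) * z), exp_mul_I_mul_cancel]

lemma isRotationOf_of_overId {f g : ℂ → ℂ} (hf : f 0 = 0) (hg : g 0 = 0) {θ : ℝ}
    (h : ∀ z, ‖z‖ < 1 → overId f z = overId g (exp (θ * I) * z)) : IsRotationOf f g := by
  refine ⟨θ, fun z hz => ?_⟩
  rw [← overId_mul hf, h z (mem_unitBall.1 hz), ← overId_mul hg, exp_neg]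
  have := exp_ne_zero (θ * I)
  field_simp

section rotationOf

variable {α θ : ℝ} {f : ℂ → ℂ}

lemma deriv_of_rotation (h : ∀ z ∈ Metric.ball (0 : ℂ) 1,
    f z = exp (-(θ * I)) * fAlpha α (exp (θ * I) * z)) {z : ℂ} (hz : ‖z‖ < 1) :
    deriv f z = deriv (fAlpha α) (exp (θ * I) * z) := by
  have e : f =ᶠ[𝓝 z] fun z => exp (-(θ * I)) * fAlpha α (exp (θ * I) * z) := by
    filter_upwards [Metric.isOpen_ball.mem_nhds (mem_unitBall.2 hz)] with y hy using h y hy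
  have hz' : ‖exp (θ * I) * z‖ < 1 := by rwa [norm_exp_mul_I_mul]
  have hd := (((hasDerivAt_fAlpha α hz').comp z
    ((hasDerivAt_id z).const_mul (exp (θ * I)))).const_mul (exp (-(θ * I)))).deriv
  rw [e.deriv_eq, deriv_fAlpha α hz']
  refine hd.trans ?_
  rw [exp_neg]
  field_simp

lemma overId_of_rotation (h : ∀ z ∈ Metric.ball (0 : ℂ) 1,
    f z = exp (-(θ * I)) * fAlpha α (exp (θ * I) * z)) {z : ℂ} (hz : ‖z‖ < 1) :
    overId f z = overId (fAlpha α) (exp (θ * I) * z) := by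
  by_cases hz0 : z = 0
  · subst hz0
    simpa [overId] using deriv_of_rotation h hz
  · simp only [overId, hz0, if_false, mul_eq_zero, exp_ne_zero, or_self, h z (mem_unitBall.2 hz)]
    rw [exp_neg]
    field_simp

end rotationOf

lemma exists_isGreatest_argValues {α : ℝ} (h0 : 0 ≤ α) (h1 : α < 1) {r : ℝ} (hr0 : 0 ≤ r)
    (hr1 : r < 1) :
    ∃ M, IsGreatest (argValues α r) M := by
  have hc : ContinuousOn (fun z : ℂ => (overId (fAlpha α) z).arg) (Metric.sphere 0 r) := by
    intro z hz
    have hz' : ‖z‖ < 1 := by rw [mem_sphere_zero_iff_norm.1 hz]; exact hr1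
    have hF := ((differentiableOn_overId (fAlpha_zero α) (differentiableOn_fAlpha α)).differentiableAt
      (Metric.isOpen_ball.mem_nhds (mem_unitBall.2 hz'))).continuousAt
    exact ((continuousAt_arg (overId_fAlpha_mem_slitPlane h0 h1 hz')).comp hF).continuousWithinAt
  exact ((isCompact_sphere (0 : ℂ) r).image_of_continuousOn hc).exists_isGreatest
    ⟨_, ⟨(r : ℂ), by simpa using hr0, rfl⟩⟩

/-- Conjugation flips the sign of the argument, so a one-sided bound on the circle is two-sided. -/
lemma abs_arg_overId_fAlpha_le {α : ℝ} (h0 : 0 ≤ α) (h1 : α < 1) {M r : ℝ}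
    (hM : M ∈ upperBounds (argValues α r)) {z : ℂ} (hz : ‖z‖ < 1) (hzr : ‖z‖ = r) :
    |(overId (fAlpha α) z).arg| ≤ M := by
  have a1 := hM ⟨z, by simpa using hzr, rfl⟩
  have a2 := hM ⟨conj z, by simpa using hzr, rfl⟩
  simp only [overId_fAlpha_conj α hz, arg_conj,
    slitPlane_arg_ne_pi (overId_fAlpha_mem_slitPlane h0 h1 hz), if_false] at a1 a2
  exact abs_le.2 ⟨by linarith, a1⟩

/-! ### The three estimates and their equality cases. -/

theorem mainTheorem8 (α : ℝ) (hα0 : 0 ≤ α) (hα1 : α < 1) (f : ℂ → ℂ) (hf : f ∈ StarlikeQ α) :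
    -- the values of the extremal function and its derivative at `-r` and `r` are real and explicit
    (∀ r : ℝ, 0 ≤ r → r < 1 →
      -fAlpha α (-(r : ℂ)) = (growthLower α r : ℂ) ∧
      fAlpha α (r : ℂ) = (growthUpper α r : ℂ) ∧
      deriv (fAlpha α) (-(r : ℂ)) = (((1 + r) ^ (2 * (α - 1)) : ℝ) : ℂ) ∧
      deriv (fAlpha α) (r : ℂ) = (((1 - r) ^ (2 * (α - 1)) : ℝ) : ℂ)) ∧
    -- growth, distortion, rotation
    (∀ (z₀ : ℂ) (r : ℝ), ‖z₀‖ = r → r < 1 →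
      (growthLower α r ≤ ‖f z₀‖ ∧ ‖f z₀‖ ≤ growthUpper α r) ∧
      ((1 + r) ^ (2 * (α - 1)) ≤ ‖deriv f z₀‖ ∧ ‖deriv f z₀‖ ≤ (1 - r) ^ (2 * (α - 1))) ∧
      (∃ M : ℝ, IsGreatest (argValues α r) M ∧ |(overId f z₀).arg| ≤ M)) ∧
    -- equality in any one of the five inequalities, at some nonzero point
    ((∃ z₀ : ℂ, z₀ ≠ 0 ∧ ‖z₀‖ < 1 ∧ ‖f z₀‖ = growthLower α ‖z₀‖) ↔
      IsRotationOf f (fAlpha α)) ∧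
    ((∃ z₀ : ℂ, z₀ ≠ 0 ∧ ‖z₀‖ < 1 ∧ ‖f z₀‖ = growthUpper α ‖z₀‖) ↔
      IsRotationOf f (fAlpha α)) ∧
    ((∃ z₀ : ℂ, z₀ ≠ 0 ∧ ‖z₀‖ < 1 ∧ ‖deriv f z₀‖ = (1 + ‖z₀‖) ^ (2 * (α - 1))) ↔
      IsRotationOf f (fAlpha α)) ∧
    ((∃ z₀ : ℂ, z₀ ≠ 0 ∧ ‖z₀‖ < 1 ∧ ‖deriv f z₀‖ = (1 - ‖z₀‖) ^ (2 * (α - 1))) ↔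
      IsRotationOf f (fAlpha α)) ∧
    ((∃ z₀ : ℂ, z₀ ≠ 0 ∧ ‖z₀‖ < 1 ∧ IsGreatest (argValues α ‖z₀‖) |(overId f z₀).arg|) ↔
      IsRotationOf f (fAlpha α)) := by
  obtain ⟨w, p, hw, hp, hexp, hder⟩ := StarlikeQ.exists_log hf
  have hf0 : f 0 = 0 := hf.1.2.1
  have hnorm : ∀ z, ‖z‖ < 1 → ‖f z‖ = ‖z‖ * Real.exp (p z).re := fun z hz => by
    rw [← overId_mul hf0, norm_mul, hexp z hz, norm_exp, mul_comm]
  have hdnorm : ∀ z, ‖z‖ < 1 → ‖deriv f z‖ = ‖qAlpha α (w z)‖ * Real.exp (p z).re :=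
    fun z hz => by rw [hder z hz, norm_mul, norm_exp]
  have habs : ∀ z : ℂ, ‖z‖ < 1 → |‖z‖| < 1 := fun z hz => by rwa [abs_norm]
  have habs' : ∀ z : ℂ, ‖z‖ < 1 → |-‖z‖| < 1 := fun z hz => by rwa [abs_neg, abs_norm]
  have hlower : ∀ z : ℂ, ‖z‖ < 1 → (1 + ‖z‖) ^ (2 * (α - 1)) =
      (qAlpha α ((-‖z‖ : ℝ) : ℂ)).re * Real.exp (logFAlpha α ((-‖z‖ : ℝ) : ℂ)).re := fun z hz => by
    rw [← rpow_eq_qAlpha_mul hα0 hα1 (habs' z hz), sub_neg_eq_add]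
  -- All equality cases rest on this: equality at one point of the Schwarz lemma makes `w` a
  -- rotation, and integrating along rays then identifies `f`.
  have dichotomy : IsRotationOf f (fAlpha α) ∨ ∀ z, z ≠ 0 → ‖z‖ < 1 → ‖w z‖ < ‖z‖ := by
    by_cases h : ∃ z, z ≠ 0 ∧ ‖z‖ < 1 ∧ ‖w z‖ = ‖z‖
    · left
      obtain ⟨z₀, hz₀, hz₁, hwz⟩ := h
      obtain ⟨θ, hθ⟩ := hw.exists_rotation hz₀ hz₁ hwz
      refine isRotationOf_of_overId hf0 (fAlpha_zero α) (θ := θ) fun z hz => ?_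
      have hz' : ‖exp (θ * I) * z‖ < 1 := by rwa [norm_exp_mul_I_mul]
      rw [hexp z hz, ← exp_logFAlpha hα0 hα1 hz']
      congr 1
      refine hp.apply_eq_apply (isLogPrimitive_logFAlpha hα0 hα1) hz hz' fun t ht0 ht1 => ?_
      rw [hθ _ (norm_ofReal_mul_lt ht0.le ht1.le hz), mul_left_comm]
    · right
      push Not at h
      exact fun z hz0 hz => (hw.norm_le hz).lt_of_ne (h z hz0 hz)
  -- Any radius in `(0, 1)` would do for exhibiting equality; the points used are `exp (-(θ * I))`
  -- times an extremal point for `f_α`.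
  have half : ‖(1 / 2 : ℂ)‖ = 1 / 2 := by norm_num
  refine ⟨fun r hr0 hr1 => ⟨?_, fAlpha_ofReal α hr1, ?_, ?_⟩, fun z r hzr hr1 => ?_,
    ⟨?_, ?_⟩, ⟨?_, ?_⟩, ⟨?_, ?_⟩, ⟨?_, ?_⟩, ⟨?_, ?_⟩⟩
  · have := fAlpha_ofReal α (r := -r) (by linarith)
    rw [growthUpper_neg] at this
    push_cast at this
    rw [this, neg_neg]
  · have := deriv_fAlpha_ofReal α (t := -r) (by rw [abs_neg, abs_of_nonneg hr0]; exact hr1)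
    rw [sub_neg_eq_add, ofReal_neg] at this
    exact this
  · exact deriv_fAlpha_ofReal α (by rwa [abs_of_nonneg hr0])
  · subst hzr
    have hz := hr1
    have hR := Real.exp_le_exp.2 (re_le_logFAlpha hα0 hα1 hp hw hz)
    have hL := Real.exp_le_exp.2 (logFAlpha_neg_le_re hα0 hα1 hp hw hz)
    refine ⟨⟨?_, ?_⟩, ⟨?_, ?_⟩, ?_⟩
    · rw [hnorm z hz, growthLower_eq (habs z hz)]
      exact mul_le_mul_of_nonneg_left hL (norm_nonneg z)
    · rw [hnorm z hz, growthUpper_eq (habs z hz)]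
      exact mul_le_mul_of_nonneg_left hR (norm_nonneg z)
    · rw [hdnorm z hz, hlower z hz]
      exact (mul_le_mul_of_nonneg_right ((qAlpha_re_ge hα0 hα1 (hw.norm_le hz) hz).trans
        (re_le_norm _)) (Real.exp_pos _).le).trans
        (mul_le_mul_of_nonneg_left hL (norm_nonneg _))
    · rw [hdnorm z hz, rpow_eq_qAlpha_mul hα0 hα1 (habs z hz)]
      exact (mul_le_mul_of_nonneg_left hR (norm_nonneg _)).trans
        (mul_le_mul_of_nonneg_right (norm_qAlpha_le hα0 hα1 (hw.norm_le hz) hz)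
          (Real.exp_pos _).le)
    · obtain ⟨M, hM⟩ := exists_isGreatest_argValues hα0 hα1 (norm_nonneg z) hz
      refine ⟨M, hM, ?_⟩
      rcases dichotomy with ⟨θ, hθ⟩ | hlt
      · rw [overId_of_rotation hθ hz]
        exact abs_arg_overId_fAlpha_le hα0 hα1 hM.2 (by rwa [norm_exp_mul_I_mul])
          (norm_exp_mul_I_mul θ z)
      · by_cases hz0 : z = 0
        · subst hz0
          rw [hexp 0 hz, hp.map_zero]
          refine le_trans ?_ (abs_arg_overId_fAlpha_le hα0 hα1 hM.2 hz rfl)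
          simp
        · obtain ⟨c, hc, hcl⟩ := exists_abs_arg_lt hα0 hα1 hp hw hlt hz hz0
          rw [hexp z hz]
          exact hcl.le.trans (hM.2 ⟨c, by simpa using hc, rfl⟩)
  · rintro ⟨z, hz0, hz, he⟩
    refine dichotomy.resolve_right fun hlt => ne_of_gt ?_ he
    rw [hnorm z hz, growthLower_eq (habs z hz)]
    exact mul_lt_mul_of_pos_left (Real.exp_lt_exp.2 (logFAlpha_neg_lt_re hα0 hα1 hp hlt hz hz0))
      (norm_pos_iff.2 hz0)
  · rintro ⟨θ, hθ⟩
    have hn : ‖exp (-(θ * I)) * (-(1 / 2 : ℂ))‖ = 1 / 2 := by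
      rw [norm_exp_neg_mul_I_mul, norm_neg, half]
    refine ⟨exp (-(θ * I)) * (-(1 / 2)), by simp [exp_ne_zero], by rw [hn]; norm_num, ?_⟩
    have hg := growthLower_eq (α := α) (t := 1 / 2) (by norm_num [abs_of_pos])
    have hu := fAlpha_ofReal α (r := -(1 / 2)) (by norm_num)
    rw [growthUpper_neg] at hu
    push_cast at hu
    rw [hθ _ (mem_unitBall.2 (by rw [hn]; norm_num)), norm_exp_neg_mul_I_mul,
      exp_mul_I_mul_cancel, hn, hu, norm_neg, norm_real, Real.norm_of_nonneg]
    rw [hg]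
    positivity
  · rintro ⟨z, hz0, hz, he⟩
    refine dichotomy.resolve_right fun hlt => ne_of_lt ?_ he
    rw [hnorm z hz, growthUpper_eq (habs z hz)]
    exact mul_lt_mul_of_pos_left (Real.exp_lt_exp.2 (re_lt_logFAlpha hα0 hα1 hp hlt hz hz0))
      (norm_pos_iff.2 hz0)
  · rintro ⟨θ, hθ⟩
    have hn : ‖exp (-(θ * I)) * (1 / 2 : ℂ)‖ = 1 / 2 := by
      rw [norm_exp_neg_mul_I_mul, half]
    refine ⟨exp (-(θ * I)) * (1 / 2), by simp [exp_ne_zero], by rw [hn]; norm_num, ?_⟩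
    have hg := growthUpper_eq (α := α) (t := 1 / 2) (by norm_num [abs_of_pos])
    have hu := fAlpha_ofReal α (r := 1 / 2) (by norm_num)
    push_cast at hu
    rw [hθ _ (mem_unitBall.2 (by rw [hn]; norm_num)), norm_exp_neg_mul_I_mul,
      exp_mul_I_mul_cancel, hn, hu, norm_real, Real.norm_of_nonneg]
    rw [hg]
    positivity
  · rintro ⟨z, hz0, hz, he⟩
    refine dichotomy.resolve_right fun hlt => ne_of_gt ?_ he
    -- One strict factor suffices: `|q_α(w(z))|` is compared strictly and `exp (Re p)` weakly.
    rw [hdnorm z hz, hlower z hz]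
    exact (mul_lt_mul_of_pos_right ((qAlpha_re_gt hα0 hα1 (hlt z hz0 hz) hz).trans_le
      (re_le_norm _)) (Real.exp_pos _)).trans_le (mul_le_mul_of_nonneg_left
        (Real.exp_le_exp.2 (logFAlpha_neg_le_re hα0 hα1 hp hw hz)) (norm_nonneg _))
  · rintro ⟨θ, hθ⟩
    have hn : ‖exp (-(θ * I)) * (-(1 / 2 : ℂ))‖ = 1 / 2 := by
      rw [norm_exp_neg_mul_I_mul, norm_neg, half]
    have hn1 : ‖exp (-(θ * I)) * (-(1 / 2 : ℂ))‖ < 1 := by rw [hn]; norm_num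
    refine ⟨exp (-(θ * I)) * (-(1 / 2)), by simp [exp_ne_zero], hn1, ?_⟩
    have hd := deriv_fAlpha_ofReal α (t := -(1 / 2)) (by norm_num [abs_of_pos])
    rw [sub_neg_eq_add] at hd
    rw [deriv_of_rotation hθ hn1, exp_mul_I_mul_cancel, hn,
      show (-(1 / 2) : ℂ) = ((-(1 / 2) : ℝ) : ℂ) by push_cast; rfl, hd, norm_real,
      Real.norm_of_nonneg (by positivity)]
  · rintro ⟨z, hz0, hz, he⟩
    refine dichotomy.resolve_right fun hlt => ne_of_lt ?_ he
    rw [hdnorm z hz, rpow_eq_qAlpha_mul hα0 hα1 (habs z hz)]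
    exact (mul_le_mul_of_nonneg_left
      (Real.exp_le_exp.2 (re_le_logFAlpha hα0 hα1 hp hw hz)) (norm_nonneg _)).trans_lt
      (mul_lt_mul_of_pos_right (norm_qAlpha_lt hα0 hα1 (hlt z hz0 hz) hz) (Real.exp_pos _))
  · rintro ⟨θ, hθ⟩
    have hn : ‖exp (-(θ * I)) * (1 / 2 : ℂ)‖ = 1 / 2 := by
      rw [norm_exp_neg_mul_I_mul, half]
    have hn1 : ‖exp (-(θ * I)) * (1 / 2 : ℂ)‖ < 1 := by rw [hn]; norm_num
    refine ⟨exp (-(θ * I)) * (1 / 2), by simp [exp_ne_zero], hn1, ?_⟩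
    have hd := deriv_fAlpha_ofReal α (t := 1 / 2) (by norm_num [abs_of_pos])
    rw [deriv_of_rotation hθ hn1, exp_mul_I_mul_cancel, hn,
      show (1 / 2 : ℂ) = ((1 / 2 : ℝ) : ℂ) by push_cast; rfl, hd, norm_real,
      Real.norm_of_nonneg (Real.rpow_nonneg (by norm_num) _)]
  · rintro ⟨z, hz0, hz, he⟩
    refine dichotomy.resolve_right fun hlt => ?_
    obtain ⟨c, hc, hcl⟩ := exists_abs_arg_lt hα0 hα1 hp hw hlt hz hz0
    rw [← hexp z hz] at hcl
    exact absurd (he.2 ⟨c, by simpa using hc, rfl⟩) (not_le.2 hcl)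
  · rintro ⟨θ, hθ⟩
    obtain ⟨M, ⟨c, hc, hcM⟩, hM⟩ := exists_isGreatest_argValues hα0 hα1 (r := 1 / 2)
      (by norm_num) (by norm_num)
    have hcn : ‖c‖ = 1 / 2 := mem_sphere_zero_iff_norm.1 hc
    have hn : ‖exp (-(θ * I)) * c‖ = 1 / 2 := by rw [norm_exp_neg_mul_I_mul, hcn]
    have hn1 : ‖exp (-(θ * I)) * c‖ < 1 := by rw [hn]; norm_num
    refine ⟨exp (-(θ * I)) * c, ?_, hn1, ?_⟩
    · rw [← norm_pos_iff, hn]; norm_num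
    · have h2 := abs_arg_overId_fAlpha_le hα0 hα1 hM (by rw [hcn]; norm_num) hcn
      have h3 : |(overId (fAlpha α) c).arg| = M :=
        le_antisymm h2 (hcM ▸ le_abs_self _)
      rw [hn, overId_of_rotation hθ hn1, exp_mul_I_mul_cancel, h3]
      exact ⟨⟨c, hc, hcM⟩, hM⟩
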